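/- Let $n,m\in\mathbb N$, let $\Omega\subset\mathbb R^n$ be a nonempty, bounded, connected open set with Lipschitz boundary, let $D\subset\Omega$ be measurable, and let $p\in(1,\infty)$, $s\in(0,1)$, $l\in\{0,1\}$, $z\ge 0$. Let $\rho\in C_c^\infty(\mathbb R^n;\mathbb R)$ be a mollifier: $\rho$ is non-negative and radially symmetric, $\int_{\mathbb R^n}\rho=1$, and there are $0<\tau<\|\rho\|_{L^\infty}$ and $\eta>0$ with $\{x:\rho(x)\ge\tau\}=\{x:|x|\le\eta\}$. Let $K=\mathrm{SPD}^{\mathrm{Log}}_z$ be the set of symmetric positive definite $M\in\mathbb R^{m\times m}$ with $\|\mathrm{Log}(M)\|_F\le z$, where $\mathrm{Log}$ is the matrix logarithm and $\|\cdot\|_F$ the Frobenius norm, and let $d(A,B)=\|\mathrm{Log}(A)-\mathrm{Log}(B)\|_F$ be the log-Euclidean metric. Let $W^{s,p}(\Omega;\mathbb R^{m\times m})$ be the space of all $w\in L^p(\Omega;\mathbb R^{m\times m})$ with $|w|_{s,p}^p:=\int_{\Omega\times\Omega}\frac{\|w(x)-w(y)\|_F^p}{|x-y|^{n+ps}}\,d(x,y)<\infty$,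 normed by $(\|w\|_{L^p}^p+|w|_{s,p}^p)^{1/p}$, and let $W^{s,p}(\Omega;K)$ and $L^p(\Omega;K)$ be the sets of those $w$ in $W^{s,p}(\Omega;\mathbb R^{m\times m})$, respectively $L^p(\Omega;\mathbb R^{m\times m})$, with $w(x)\in K$ for a.e. $x\in\Omega$. For $\alpha>0$, $v\in L^p(\Omega;K)$ and $w\in W^{s,p}(\Omega;K)$ put $$\Phi(w)=\int_{\Omega\times\Omega}\frac{d^p(w(x),w(y))}{|x-y|^{n+ps}}\,\rho^l(x-y)\,d(x,y),\qquad \mathcal F^{\alpha,v}(w)=\int_{\Omega}\chi_{\Omega\setminus D}(x)\,d^p(w(x),v(x))\,dx+\alpha\,\Phi(w).$$ Then the following hold. - **Existence.** For every $v\in L^p(\Omega;K)$ and $\alpha>0$ the functional $\mathcal F^{\alpha,v}$ takes finite values on $W^{s,p}(\Omega;K)$ and attains a minimizer there. - **Stability.** Let $\alpha>0$, $w^\delta\in L^p(\Omega;K)$, and let $v_k\in L^p(\Omega;K)$ with $\|w^\delta-v_k\|_{L^p}\to0$. Then every sequence $(w_k)$ of minimizers $w_k$ of $\mathcal F^{\alpha,v_k}$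 over $W^{s,p}(\Omega;K)$ has a subsequence converging weakly in $W^{s,p}(\Omega;\mathbb R^{m\times m})$. The weak limit $\tilde w$ of every weakly converging subsequence $(w_{k_j})$ is a minimizer of $\mathcal F^{\alpha,w^\delta}$ over $W^{s,p}(\Omega;K)$, and $\Phi(w_{k_j})\to\Phi(\tilde w)$. - **Convergence.** Suppose that $\Omega\setminus D$ is not a null set and that the true solution $w^0\in W^{s,p}(\Omega;K)$ satisfies $\Phi(w^0)\le\Phi(u)$ for all $u\in W^{s,p}(\Omega;K)$ with $u=w^0$ a.e. on $\Omega\setminus D$ (both conditions are automatic if $D$ is a null set, in particular for denoising, $D=\emptyset$). Let $\alpha:(0,\infty)\to(0,\infty)$ satisfy $\alpha(\delta)\to0$ and $\delta^p/\alpha(\delta)\to0$ as $\delta\to0$, let $\delta_k>0$ with $\delta_k\to0$, and let $v_k\in L^p(\Omega;K)$ with $\|w^0-v_k\|_{L^p}\le\delta_k$. Then every sequence $(w_k)$ of minimizers $w_k$ of $\mathcal F^{\alpha(\delta_k),v_k}$ over $W^{s,p}(\Omega;K)$ has a subsequence $(w_{k_j})$ with $w_{k_j}\rightharpoonup w^0$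 weakly in $W^{s,p}(\Omega;\mathbb R^{m\times m})$ and $\Phi(w_{k_j})\to\Phi(w^0)$; moreover the whole sequence satisfies $w_k\rightharpoonup w^0$ and $\Phi(w_k)\to\Phi(w^0)$. -/

import Mathlib

open MeasureTheory Filter Topology
open scoped ENNReal

namespace TensorReg

/-- The matrix logarithm `Log (V diag(μ) Vᵀ) = V diag(log μ) Vᵀ` of a symmetric matrix. -/
noncomputable def matLog {m : ℕ} (A : Matrix (Fin m) (Fin m) ℝ) : Matrix (Fin m) (Fin m) ℝ :=
  cfc Real.log A

/-- `matLog` is given by the eigendecomposition of the matrix. -/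
theorem matLog_eq {m : ℕ} {A : Matrix (Fin m) (Fin m) ℝ} (hA : A.IsHermitian) :
    matLog A = (hA.eigenvectorUnitary : Matrix (Fin m) (Fin m) ℝ) *
      Matrix.diagonal (fun i => Real.log (hA.eigenvalues i)) *
      star (hA.eigenvectorUnitary : Matrix (Fin m) (Fin m) ℝ) := by
  rw [matLog, hA.cfc_eq]
  simp [Matrix.IsHermitian.cfc, Function.comp_def, Unitary.conjStarAlgAut_apply]

/-- `ℝⁿ` with the Euclidean norm. -/
abbrev Space (n : ℕ) := EuclideanSpace ℝ (Fin n)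

/-- `ℝ^{m×m}` with the Frobenius norm, the Euclidean norm of the family of entries. -/
abbrev Mat (m : ℕ) := EuclideanSpace ℝ (Fin m × Fin m)

/-- An element of `ℝ^{m×m}` as a matrix. -/
def Mat.toMatrix {m : ℕ} (A : Mat m) : Matrix (Fin m) (Fin m) ℝ := Matrix.of fun i j => A (i, j)

/-- A matrix as an element of `ℝ^{m×m}` with the Frobenius norm. -/
def Mat.ofMatrix {m : ℕ} (A : Matrix (Fin m) (Fin m) ℝ) : Mat m :=
  WithLp.toLp 2 fun q => A q.1 q.2

/-- The norm on `Mat m` is the Frobenius norm. -/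
theorem Mat.norm_ofMatrix {m : ℕ} (A : Matrix (Fin m) (Fin m) ℝ) :
    ‖Mat.ofMatrix A‖ = Real.sqrt (∑ i, ∑ j, |A i j| ^ 2) := by
  rw [EuclideanSpace.norm_eq, Fintype.sum_prod_type]
  simp [Mat.ofMatrix]

/-- The matrix logarithm on `Mat m`. -/
noncomputable def Log {m : ℕ} (A : Mat m) : Mat m := Mat.ofMatrix (matLog A.toMatrix)

/-- The symmetric positive definite matrices `M` with `‖Log M‖_F ≤ z`. -/
def SPDLog (m : ℕ) (z : ℝ) : Set (Mat m) :=
  {M | M.toMatrix.PosDef ∧ ‖Log M‖ ≤ z}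

/-- The log-Euclidean metric `‖Log A - Log B‖_F`. -/
noncomputable def logDist {m : ℕ} (A B : Mat m) : ℝ := ‖Log A - Log B‖

/-- Lipschitz boundary: near every boundary point, `Ω` is the strict epigraph, in some unit
direction `e`, of a Lipschitz function of the component orthogonal to `e`. -/
def HasLipschitzBoundary {n : ℕ} (Ω : Set (Space n)) : Prop :=
  ∀ x ∈ frontier Ω, ∃ (e : Space n) (r : ℝ) (L : NNReal) (g : Space n → ℝ),
    ‖e‖ = 1 ∧ 0 < r ∧ LipschitzWith L g ∧
    ∀ y ∈ Metric.ball x r, y ∈ Ω ↔ g (y - inner ℝ e y • e) < inner ℝ e y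

/-- Mollifiers. -/
structure IsMollifier {n : ℕ} (ρ : Space n → ℝ) : Prop where
  smooth : ContDiff ℝ ((⊤ : ℕ∞) : WithTop ℕ∞) ρ
  compactSupport : HasCompactSupport ρ
  nonneg : ∀ x, 0 ≤ ρ x
  radial : ∀ x y, ‖x‖ = ‖y‖ → ρ x = ρ y
  integral_eq_one : ∫ x, ρ x = 1
  superlevel : ∃ τ η : ℝ, 0 < τ ∧ ENNReal.ofReal τ < eLpNorm ρ ⊤ volume ∧ 0 < η ∧
    {x | τ ≤ ρ x} = {x | ‖x‖ ≤ η}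

/-- Lebesgue measure on `Ω × Ω`. -/
noncomputable abbrev volSq {n : ℕ} (Ω : Set (Space n)) : Measure (Space n × Space n) :=
  (volume.restrict Ω).prod (volume.restrict Ω)

/-- The difference quotient `‖w(x) - w(y)‖_F / |x - y|^(n/p + s)`. -/
noncomputable def diffQuot {n m : ℕ} (s p : ℝ) (w : Space n → Mat m) (q : Space n × Space n) : ℝ :=
  ‖w q.1 - w q.2‖ / ‖q.1 - q.2‖ ^ ((n : ℝ) / p + s)

theorem aestronglyMeasurable_diffQuot {n m : ℕ} {Ω : Set (Space n)} {s p : ℝ}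
    {w : Space n → Mat m} (hw : AEStronglyMeasurable w (volume.restrict Ω)) :
    AEStronglyMeasurable (diffQuot s p w) (volSq Ω) := by
  have h1 : AEStronglyMeasurable (fun q : Space n × Space n => w q.1 - w q.2) (volSq Ω) :=
    hw.comp_fst.sub hw.comp_snd
  have h2 : Measurable fun q : Space n × Space n => ‖q.1 - q.2‖ ^ ((n : ℝ) / p + s) := by
    fun_prop
  exact (h1.norm.aemeasurable.div h2.aemeasurable).aestronglyMeasurable

/-- The fractional Sobolev space `W^{s,p}(Ω; ℝ^{m×m})`, as the space of representatives: functions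
whose restriction to `Ω` is in `L^p` and whose difference quotient is in `L^p(Ω × Ω)`. -/
def Wsp {n : ℕ} (m : ℕ) (Ω : Set (Space n)) (s p : ℝ) : Submodule ℝ (Space n → Mat m) where
  carrier := {w | MemLp w (ENNReal.ofReal p) (volume.restrict Ω) ∧
    MemLp (diffQuot s p w) (ENNReal.ofReal p) (volSq Ω)}
  zero_mem' := by
    refine ⟨MemLp.zero, ?_⟩
    have : diffQuot s p (0 : Space n → Mat m) = 0 := by
      funext q; simp [diffQuot]
    rw [this]
    exact MemLp.zero
  add_mem' := by
    rintro u v ⟨hu, hu'⟩ ⟨hv, hv'⟩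
    refine ⟨hu.add hv, (hu'.add hv').mono
      (aestronglyMeasurable_diffQuot (hu.add hv).aestronglyMeasurable) (Eventually.of_forall ?_)⟩
    intro q
    have h0 : 0 ≤ ‖q.1 - q.2‖ ^ ((n : ℝ) / p + s) := by positivity
    simp only [diffQuot, Pi.add_apply, Real.norm_eq_abs]
    rw [abs_of_nonneg (by positivity), abs_of_nonneg (by positivity), ← add_div]
    refine div_le_div_of_nonneg_right ?_ h0
    rw [add_sub_add_comm]
    exact norm_add_le _ _
  smul_mem' := by
    rintro c u ⟨hu, hu'⟩
    refine ⟨hu.const_smul c, ?_⟩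
    have : diffQuot s p (c • u) = fun q => ‖c‖ * diffQuot s p u q := by
      funext q
      simp only [diffQuot, Pi.smul_apply]
      rw [← smul_sub, norm_smul, mul_div_assoc]
    rw [this]
    exact hu'.const_mul _

/-- The norm of `W^{s,p}(Ω; ℝ^{m×m})`; it vanishes exactly on the functions that are zero almost
everywhere on `Ω`. -/
noncomputable def wspNorm {n m : ℕ} (Ω : Set (Space n)) (s p : ℝ) (w : Space n → Mat m) : ℝ :=
  ((eLpNorm w (ENNReal.ofReal p) (volume.restrict Ω)).toReal ^ p +
    (eLpNorm (diffQuot s p w) (ENNReal.ofReal p) (volSq Ω)).toReal ^ p) ^ (1 / p)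

/-- Weak convergence `u k ⇀ w` in `W^{s,p}(Ω; ℝ^{m×m})`: convergence under all bounded linear
functionals (a bounded functional does not distinguish functions equal a.e. on `Ω`). -/
def WeakTendsto {n m : ℕ} (Ω : Set (Space n)) (s p : ℝ) (u : ℕ → Space n → Mat m)
    (w : Space n → Mat m) : Prop :=
  ∃ (hu : ∀ k, u k ∈ Wsp m Ω s p) (hw : w ∈ Wsp m Ω s p),
    ∀ f : Wsp m Ω s p →ₗ[ℝ] ℝ,
      (∃ C : ℝ, ∀ v : Wsp m Ω s p, |f v| ≤ C * wspNorm Ω s p (v : Space n → Mat m)) →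
      Tendsto (fun k => f ⟨u k, hu k⟩) atTop (𝓝 (f ⟨w, hw⟩))

/-- The set `W^{s,p}(Ω; K)`. -/
def WspSet {n m : ℕ} (Ω : Set (Space n)) (s p : ℝ) (K : Set (Mat m)) : Set (Space n → Mat m) :=
  {w | w ∈ Wsp m Ω s p ∧ ∀ᵐ x ∂(volume.restrict Ω), w x ∈ K}

/-- The set `L^p(Ω; K)`. -/
def LpSet {n m : ℕ} (Ω : Set (Space n)) (p : ℝ) (K : Set (Mat m)) : Set (Space n → Mat m) :=
  {w | MemLp w (ENNReal.ofReal p) (volume.restrict Ω) ∧ ∀ᵐ x ∂(volume.restrict Ω), w x ∈ K}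

/-- The regularizer
`Φ(w) = ∫_{Ω×Ω} d(w(x), w(y))^p / |x - y|^(n + p s) * ρ(x - y)^l d(x,y)`
for the log-Euclidean metric `d`. -/
noncomputable def Phi {n m : ℕ} (Ω : Set (Space n)) (s p : ℝ) (l : ℕ) (ρ : Space n → ℝ)
    (w : Space n → Mat m) : ℝ≥0∞ :=
  ∫⁻ q, ENNReal.ofReal (logDist (w q.1) (w q.2) ^ p / ‖q.1 - q.2‖ ^ ((n : ℝ) + p * s) *
    ρ (q.1 - q.2) ^ l) ∂(volSq Ω)

/-- The functional `F^{α,v}(w) = ∫_Ω χ_{Ω∖D}(x) d(w(x), v(x))^p dx + α Φ(w)`. -/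
noncomputable def Func {n m : ℕ} (Ω D : Set (Space n)) (s p : ℝ) (l : ℕ) (ρ : Space n → ℝ)
    (α : ℝ) (v w : Space n → Mat m) : ℝ≥0∞ :=
  (∫⁻ x in Ω, (Ω \ D).indicator (fun x => ENNReal.ofReal (logDist (w x) (v x) ^ p)) x) +
    ENNReal.ofReal α * Phi Ω s p l ρ w

/-- `w` minimizes `F^{α,v}` over `W^{s,p}(Ω; K)`. -/
def IsMinimizer {n m : ℕ} (Ω D : Set (Space n)) (s p : ℝ) (l : ℕ) (ρ : Space n → ℝ)
    (K : Set (Mat m)) (α : ℝ) (v w : Space n → Mat m) : Prop :=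
  w ∈ WspSet Ω s p K ∧ ∀ u ∈ WspSet Ω s p K, Func Ω D s p l ρ α v w ≤ Func Ω D s p l ρ α v u

/-- `w⁰` is a true solution: it lies in `W^{s,p}(Ω; K)` and has the least regularizer value among
all elements of `W^{s,p}(Ω; K)` which agree with it where data are available, i.e. on `Ω ∖ D`.
The second condition is void if `D` is a null set. -/
def IsTrueSolution {n m : ℕ} (Ω D : Set (Space n)) (s p : ℝ) (l : ℕ) (ρ : Space n → ℝ)
    (K : Set (Mat m)) (w0 : Space n → Mat m) : Prop :=
  w0 ∈ WspSet Ω s p K ∧ ∀ u ∈ WspSet Ω s p K,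
    (∀ᵐ x ∂(volume.restrict (Ω \ D)), u x = w0 x) → Phi Ω s p l ρ w0 ≤ Phi Ω s p l ρ u

end TensorReg

open TensorReg

/-! On `SPDLog m z` the matrix logarithm is bi-Lipschitz onto the ball of radius `z` in the
symmetric matrices, which is closed and convex, and there `logDist` becomes the Frobenius distance.
If `Λ` is this chart and `E` its inverse, `Phi` of `w` is the `p`-th power of a weighted `L^p` norm
of the difference quotient of `Λ ∘ w`, and the fidelity is the `p`-th power of an `L^p` norm of `Λ ∘
w - Λ ∘ v` (`Setting.phi_eq`, `Setting.func_eq`). The problem is thereby convex in `Λ ∘ w`.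

The direct method then needs three facts. Coercivity (`Setting.coercive`): the kernel is bounded
below near the diagonal, and away from it the difference quotients are bounded because the chart is.
Compactness (`exists_subseq_cauchy`): a sequence bounded in the Gagliardo seminorm and uniformly
bounded is `L^p` close to its averages over small disjoint balls, and these averages converge along
a subsequence. Semicontinuity: Fatou for `Phi`, while the fidelity is continuous under `L^p`
convergence. `Setting.isMinimizer_of_tendsto` combines them for almost minimizers with varying data
and so yields existence and stability together.

Weak convergence in `W^{s,p}` is reduced to `L^p` convergence. A bounded sequence tending to zero in
`L^p` has convex combinations of its tails tending to zero in norm, by uniform convexity of `L^p`,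
so every bounded functional tends to zero along it (`Wsp.tendsto_functional_zero`). Conversely, weak
limits are unique a.e., so compactness turns weak convergence into `L^p` convergence
(`Setting.tendsto_of_weakTendsto`).

For vanishing noise, comparison with the true solution `w0` forces the fidelity to zero and the
limit superior of `Phi` below its value at `w0`. A subsequential limit therefore agrees with `w0` on
`Ω \ D` and has no larger regularizer. Testing with the chart midpoint and using strict convexity,
the two difference quotients agree wherever the kernel is positive; the chart difference is then
locally constant, hence constant on the connected set `Ω`, hence zero
(`Setting.ae_eq_of_isTrueSolution`). As every subsequence has a further one with this limit, the
whole sequence converges. -/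

namespace TensorReg

/-! ### The matrix logarithm as a bi-Lipschitz chart -/

section MatrixLog

variable {m : ℕ}

theorem Mat.norm_sq_ofMatrix (A : Matrix (Fin m) (Fin m) ℝ) :
    ‖Mat.ofMatrix A‖ ^ 2 = (star A * A).trace := by
  rw [Mat.norm_ofMatrix, Real.sq_sqrt (by positivity), Finset.sum_comm]
  simp [Matrix.trace, Matrix.mul_apply, Matrix.star_apply, sq]

/-- The Frobenius norm is invariant under orthogonal transformations. -/
theorem Mat.norm_ofMatrix_conj (U V : Matrix.unitaryGroup (Fin m) ℝ)
    (A : Matrix (Fin m) (Fin m) ℝ) :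
    ‖Mat.ofMatrix (star (U : Matrix (Fin m) (Fin m) ℝ) * A *
      (V : Matrix (Fin m) (Fin m) ℝ))‖ = ‖Mat.ofMatrix A‖ := by
  have hU : (U : Matrix (Fin m) (Fin m) ℝ) * star (U : Matrix (Fin m) (Fin m) ℝ) = 1 :=
    Unitary.mul_star_self_of_mem U.2
  have hV : (V : Matrix (Fin m) (Fin m) ℝ) * star (V : Matrix (Fin m) (Fin m) ℝ) = 1 :=
    Unitary.mul_star_self_of_mem V.2
  rw [← sq_eq_sq₀ (norm_nonneg _) (norm_nonneg _), Mat.norm_sq_ofMatrix, Mat.norm_sq_ofMatrix]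
  have h : star (star (U : Matrix (Fin m) (Fin m) ℝ) * A * (V : Matrix (Fin m) (Fin m) ℝ)) *
      (star (U : Matrix (Fin m) (Fin m) ℝ) * A * (V : Matrix (Fin m) (Fin m) ℝ)) =
      star (V : Matrix (Fin m) (Fin m) ℝ) * (star A * A * (V : Matrix (Fin m) (Fin m) ℝ)) := by
    simp only [star_mul, star_star, mul_assoc]
    rw [← mul_assoc (U : Matrix (Fin m) (Fin m) ℝ) (star _), hU, one_mul]
  rw [h, Matrix.trace_mul_comm, mul_assoc, hV, mul_one]

theorem cfc_eq_conj_diagonal {A : Matrix (Fin m) (Fin m) ℝ} (hA : A.IsHermitian) (f : ℝ → ℝ) :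
    cfc f A = (hA.eigenvectorUnitary : Matrix (Fin m) (Fin m) ℝ) *
      Matrix.diagonal (fun i => f (hA.eigenvalues i)) *
      star (hA.eigenvectorUnitary : Matrix (Fin m) (Fin m) ℝ) := by
  rw [hA.cfc_eq]
  simp [Matrix.IsHermitian.cfc, Function.comp_def, Unitary.conjStarAlgAut_apply]

/-- Using the eigenbasis of `A` on the left and that of `B` on the right turns the difference into
an entrywise multiple of a matrix that does not depend on `f`. Differences for two functions can
thus be compared entry by entry although `A` and `B` need not commute. -/
theorem conj_cfc_sub_cfc_apply {A B : Matrix (Fin m) (Fin m) ℝ} (hA : A.IsHermitian)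
    (hB : B.IsHermitian) (f : ℝ → ℝ) (i j : Fin m) :
    (star (hA.eigenvectorUnitary : Matrix (Fin m) (Fin m) ℝ) * (cfc f A - cfc f B) *
      (hB.eigenvectorUnitary : Matrix (Fin m) (Fin m) ℝ)) i j =
    (f (hA.eigenvalues i) - f (hB.eigenvalues j)) *
      (star (hA.eigenvectorUnitary : Matrix (Fin m) (Fin m) ℝ) *
        (hB.eigenvectorUnitary : Matrix (Fin m) (Fin m) ℝ)) i j := by
  set U := (hA.eigenvectorUnitary : Matrix (Fin m) (Fin m) ℝ) with hUdef
  set V := (hB.eigenvectorUnitary : Matrix (Fin m) (Fin m) ℝ) with hVdef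
  have hU : star U * U = 1 := Unitary.star_mul_self_of_mem hA.eigenvectorUnitary.2
  have hV : star V * V = 1 := Unitary.star_mul_self_of_mem hB.eigenvectorUnitary.2
  have h : star U * (cfc f A - cfc f B) * V =
      Matrix.diagonal (fun i => f (hA.eigenvalues i)) * (star U * V) -
        (star U * V) * Matrix.diagonal (fun i => f (hB.eigenvalues i)) := by
    rw [cfc_eq_conj_diagonal hA, cfc_eq_conj_diagonal hB, ← hUdef, ← hVdef, mul_sub, sub_mul]
    congr 1
    · simp only [← mul_assoc]
      rw [hU, one_mul]
    · simp only [mul_assoc]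
      rw [hV, mul_one]
  rw [h, Matrix.sub_apply, Matrix.diagonal_mul, Matrix.mul_diagonal]
  ring

/-- If `f` is Lipschitz relative to `g` between the spectra of two symmetric matrices, then the
Frobenius distance of `f(A)` and `f(B)` is controlled by that of `g(A)` and `g(B)`. -/
theorem norm_cfc_sub_cfc_le {A B : Matrix (Fin m) (Fin m) ℝ} (hA : A.IsHermitian)
    (hB : B.IsHermitian) (f g : ℝ → ℝ) {C : ℝ} (hC : 0 ≤ C)
    (h : ∀ i j, |f (hA.eigenvalues i) - f (hB.eigenvalues j)| ≤
      C * |g (hA.eigenvalues i) - g (hB.eigenvalues j)|) :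
    ‖Mat.ofMatrix (cfc f A - cfc f B)‖ ≤ C * ‖Mat.ofMatrix (cfc g A - cfc g B)‖ := by
  rw [← Mat.norm_ofMatrix_conj hA.eigenvectorUnitary hB.eigenvectorUnitary (cfc f A - cfc f B),
    ← Mat.norm_ofMatrix_conj hA.eigenvectorUnitary hB.eigenvectorUnitary (cfc g A - cfc g B),
    Mat.norm_ofMatrix, Mat.norm_ofMatrix]
  rw [← Real.sqrt_sq hC, ← Real.sqrt_mul (sq_nonneg C)]
  refine Real.sqrt_le_sqrt ?_
  rw [Finset.mul_sum]
  refine Finset.sum_le_sum fun i _ => ?_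
  rw [Finset.mul_sum]
  refine Finset.sum_le_sum fun j _ => ?_
  rw [conj_cfc_sub_cfc_apply, conj_cfc_sub_cfc_apply, abs_mul, abs_mul, mul_pow, mul_pow,
    ← mul_assoc, ← mul_pow C]
  gcongr
  exact h i j

theorem Mat.norm_cfc_sq {A : Matrix (Fin m) (Fin m) ℝ} (hA : A.IsHermitian) (f : ℝ → ℝ) :
    ‖Mat.ofMatrix (cfc f A)‖ ^ 2 = ∑ i, f (hA.eigenvalues i) ^ 2 := by
  have hU : star (hA.eigenvectorUnitary : Matrix (Fin m) (Fin m) ℝ) *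
      (hA.eigenvectorUnitary : Matrix (Fin m) (Fin m) ℝ) = 1 :=
    Unitary.star_mul_self_of_mem hA.eigenvectorUnitary.2
  rw [← Mat.norm_ofMatrix_conj hA.eigenvectorUnitary hA.eigenvectorUnitary,
    cfc_eq_conj_diagonal hA]
  rw [show ∀ U D : Matrix (Fin m) (Fin m) ℝ, star U * (U * D * star U) * U =
    (star U * U) * D * (star U * U) from fun U D => by simp only [mul_assoc], hU, one_mul, mul_one,
    Mat.norm_sq_ofMatrix]
  simp [Matrix.trace, Matrix.star_eq_conjTranspose, sq]

theorem abs_eigenvalue_le {A : Matrix (Fin m) (Fin m) ℝ} (hA : A.IsHermitian) (f : ℝ → ℝ) {z : ℝ}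
    (hz : 0 ≤ z) (h : ‖Mat.ofMatrix (cfc f A)‖ ≤ z) (i : Fin m) :
    |f (hA.eigenvalues i)| ≤ z := by
  refine abs_le_of_sq_le_sq ?_ hz
  calc f (hA.eigenvalues i) ^ 2 ≤ ∑ i, f (hA.eigenvalues i) ^ 2 :=
        Finset.single_le_sum (f := fun i => f (hA.eigenvalues i) ^ 2)
          (fun _ _ => sq_nonneg _) (Finset.mem_univ i)
    _ = ‖Mat.ofMatrix (cfc f A)‖ ^ 2 := (Mat.norm_cfc_sq hA f).symm
    _ ≤ z ^ 2 := by gcongr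

@[simp] theorem Mat.toMatrix_ofMatrix (A : Matrix (Fin m) (Fin m) ℝ) :
    (Mat.ofMatrix A).toMatrix = A := rfl

@[simp] theorem Mat.ofMatrix_toMatrix (A : Mat m) : Mat.ofMatrix A.toMatrix = A := rfl

theorem Mat.ofMatrix_sub (A B : Matrix (Fin m) (Fin m) ℝ) :
    Mat.ofMatrix (A - B) = Mat.ofMatrix A - Mat.ofMatrix B := rfl

/-- The symmetric matrices of Frobenius norm at most `z`. -/
def symBall (m : ℕ) (z : ℝ) : Set (Mat m) := {L | L.toMatrix.IsHermitian ∧ ‖L‖ ≤ z}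

/-- The matrix exponential of symmetric matrices on `Mat m`. -/
noncomputable def Exp (A : Mat m) : Mat m := Mat.ofMatrix (cfc Real.exp A.toMatrix)

theorem isClosed_symBall (z : ℝ) : IsClosed (symBall m z) := by
  have h1 : IsClosed {L : Mat m | ∀ i j, L (j, i) = L (i, j)} := by
    simp only [Set.ofPred_forall]
    refine isClosed_iInter fun i => isClosed_iInter fun j => ?_
    exact isClosed_eq (by fun_prop) (by fun_prop)
  convert h1.inter (isClosed_le continuous_norm (continuous_const (y := z))) using 1
  ext L
  exact and_congr Matrix.IsHermitian.ext_iff Iff.rfl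

theorem midpoint_mem_symBall {z : ℝ} {A B : Mat m} (hA : A ∈ symBall m z) (hB : B ∈ symBall m z) :
    (2⁻¹ : ℝ) • (A + B) ∈ symBall m z := by
  refine ⟨?_, ?_⟩
  · have h1 := hA.1
    have h2 := hB.1
    rw [Matrix.IsHermitian.ext_iff] at h1 h2 ⊢
    intro i j
    have := h1 i j
    have := h2 i j
    simp_all [Mat.toMatrix]
  · rw [norm_smul]
    have := norm_add_le A B
    have h1 := hA.2
    have h2 := hB.2
    norm_num
    linarith

theorem Log_mem_symBall {z : ℝ} {A : Mat m} (hA : A ∈ SPDLog m z) : Log A ∈ symBall m z :=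
  ⟨cfc_predicate (R := ℝ) Real.log A.toMatrix, hA.2⟩

theorem Exp_Log {z : ℝ} {A : Mat m} (hA : A ∈ SPDLog m z) : Exp (Log A) = A := by
  have hH := hA.1.isHermitian
  have hpos : ∀ x ∈ spectrum ℝ A.toMatrix, 0 < x := by
    rw [hH.spectrum_real_eq_range_eigenvalues]
    rintro _ ⟨i, rfl⟩
    exact hA.1.eigenvalues_pos i
  have h : cfc Real.exp (cfc Real.log A.toMatrix) = A.toMatrix := by
    rw [← cfc_comp Real.exp Real.log A.toMatrix hH.isSelfAdjoint (by fun_prop)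
      (Real.continuousOn_log.mono fun x hx => (hpos x hx).ne')]
    conv_rhs => rw [← cfc_id ℝ A.toMatrix hH.isSelfAdjoint]
    exact cfc_congr fun x hx => Real.exp_log (hpos x hx)
  rw [Exp, Log, Mat.toMatrix_ofMatrix, matLog, h, Mat.ofMatrix_toMatrix]

theorem Log_Exp {A : Mat m} (hA : A.toMatrix.IsHermitian) : Log (Exp A) = A := by
  have h : cfc Real.log (cfc Real.exp A.toMatrix) = A.toMatrix := by
    rw [← cfc_comp Real.log Real.exp A.toMatrix hA.isSelfAdjoint
      (Real.continuousOn_log.mono (by rintro _ ⟨x, -, rfl⟩; exact (Real.exp_pos x).ne'))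
      (by fun_prop)]
    conv_rhs => rw [← cfc_id ℝ A.toMatrix hA.isSelfAdjoint]
    exact cfc_congr fun x hx => Real.log_exp x
  rw [Exp, Log, Mat.toMatrix_ofMatrix, matLog, h, Mat.ofMatrix_toMatrix]

theorem posDef_cfc_exp {A : Matrix (Fin m) (Fin m) ℝ} (hA : A.IsHermitian) :
    (cfc Real.exp A).PosDef := by
  have hH : (cfc Real.exp A).IsHermitian := cfc_predicate (R := ℝ) Real.exp A
  rw [hH.posDef_iff_eigenvalues_pos]
  intro i
  have := hH.eigenvalues_mem_spectrum_real i
  rw [cfc_map_spectrum (R := ℝ) Real.exp A hA.isSelfAdjoint (by fun_prop)] at this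
  obtain ⟨x, -, hx⟩ := this
  rw [← hx]
  exact Real.exp_pos x

theorem Exp_mem {z : ℝ} {A : Mat m} (hA : A ∈ symBall m z) : Exp A ∈ SPDLog m z :=
  ⟨posDef_cfc_exp hA.1, by rw [Log_Exp hA.1]; exact hA.2⟩

theorem abs_exp_sub_exp_le {z x y : ℝ} (hx : |x| ≤ z) (hy : |y| ≤ z) :
    |Real.exp x - Real.exp y| ≤ Real.exp z * |x - y| := by
  have := (convex_Icc (-z) z).norm_image_sub_le_of_norm_deriv_le (f := Real.exp)
    (C := Real.exp z) (fun x _ => Real.differentiableAt_exp)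
    (fun x hx => by
      rw [Real.deriv_exp, Real.norm_eq_abs, abs_of_pos (Real.exp_pos x)]
      exact Real.exp_le_exp.2 hx.2) (abs_le.1 hy) (abs_le.1 hx)
  simpa [Real.norm_eq_abs] using this

/-- The bound on the logarithm keeps both points above `exp (-z)`, where the derivative of `log` is
at most `exp z`. -/
theorem abs_log_sub_log_le {z x y : ℝ} (hx0 : 0 < x) (hy0 : 0 < y) (hx : |Real.log x| ≤ z)
    (hy : |Real.log y| ≤ z) : |Real.log x - Real.log y| ≤ Real.exp z * |x - y| := by
  have key : ∀ t, 0 < t → |Real.log t| ≤ z → Real.exp (-z) ≤ t := fun t ht h => by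
    rw [← Real.exp_log ht]
    exact Real.exp_le_exp.2 (abs_le.1 h).1
  have := (convex_Ici (Real.exp (-z))).norm_image_sub_le_of_norm_deriv_le (f := Real.log)
    (C := Real.exp z)
    (fun x hx => Real.differentiableAt_log ((Real.exp_pos _).trans_le hx).ne')
    (fun x hx => by
      have hx' : 0 < x := (Real.exp_pos _).trans_le hx
      rw [Real.deriv_log, Real.norm_eq_abs, abs_of_pos (inv_pos.2 hx'), ← inv_inv (Real.exp z),
        ← Real.exp_neg]
      exact inv_anti₀ (Real.exp_pos _) hx) (key y hy0 hy) (key x hx0 hx)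
  simpa [Real.norm_eq_abs] using this

theorem norm_Log_sub_Log_le {z : ℝ} (hz : 0 ≤ z) {A B : Mat m} (hA : A ∈ SPDLog m z)
    (hB : B ∈ SPDLog m z) : ‖Log A - Log B‖ ≤ Real.exp z * ‖A - B‖ := by
  have hA' := hA.1.isHermitian
  have hB' := hB.1.isHermitian
  have := norm_cfc_sub_cfc_le hA' hB' Real.log id (Real.exp_pos z).le fun i j =>
    abs_log_sub_log_le (hA.1.eigenvalues_pos i) (hB.1.eigenvalues_pos j)
      (abs_eigenvalue_le hA' _ hz hA.2 i) (abs_eigenvalue_le hB' _ hz hB.2 j)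
  rwa [cfc_id ℝ A.toMatrix hA'.isSelfAdjoint, cfc_id ℝ B.toMatrix hB'.isSelfAdjoint,
    Mat.ofMatrix_sub, Mat.ofMatrix_sub] at this

theorem norm_Exp_sub_Exp_le {z : ℝ} (hz : 0 ≤ z) {A B : Mat m} (hA : A ∈ symBall m z)
    (hB : B ∈ symBall m z) : ‖Exp A - Exp B‖ ≤ Real.exp z * ‖A - B‖ := by
  have hA' := hA.1
  have hB' := hB.1
  have h1 : ‖Mat.ofMatrix (cfc (id : ℝ → ℝ) A.toMatrix)‖ ≤ z := by
    rw [cfc_id ℝ A.toMatrix hA'.isSelfAdjoint]; exact hA.2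
  have h2 : ‖Mat.ofMatrix (cfc (id : ℝ → ℝ) B.toMatrix)‖ ≤ z := by
    rw [cfc_id ℝ B.toMatrix hB'.isSelfAdjoint]; exact hB.2
  have := norm_cfc_sub_cfc_le hA' hB' Real.exp id (Real.exp_pos z).le fun i j =>
    abs_exp_sub_exp_le (abs_eigenvalue_le hA' _ hz h1 i) (abs_eigenvalue_le hB' _ hz h2 j)
  rwa [cfc_id ℝ A.toMatrix hA'.isSelfAdjoint, cfc_id ℝ B.toMatrix hB'.isSelfAdjoint,
    Mat.ofMatrix_sub, Mat.ofMatrix_sub] at this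

/-- `Λ` and `E` are Lipschitz maps which restrict to mutually inverse bijections between `K` and a
closed set of vectors of norm at most `z` that contains midpoints. -/
structure IsChart (K : Set (Mat m)) (z : ℝ) (L : NNReal) (Λ E : Mat m → Mat m) : Prop where
  lip : LipschitzWith L Λ
  lip' : LipschitzWith L E
  left_inv : ∀ A ∈ K, E (Λ A) = A
  norm_le : ∀ A ∈ K, ‖Λ A‖ ≤ z
  mid_mem : ∀ A ∈ K, ∀ B ∈ K, E ((2⁻¹ : ℝ) • (Λ A + Λ B)) ∈ K
  mid_eq : ∀ A ∈ K, ∀ B ∈ K, Λ (E ((2⁻¹ : ℝ) • (Λ A + Λ B))) = (2⁻¹ : ℝ) • (Λ A + Λ B)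
  isClosed : IsClosed K
  nonempty : K.Nonempty

/-- The matrix logarithm is a chart of `SPDLog m z`. -/
theorem exists_isChart_SPDLog (m : ℕ) {z : ℝ} (hz : 0 ≤ z) :
    ∃ L Λ E, IsChart (SPDLog m z) z L Λ E ∧ ∀ A ∈ SPDLog m z, Λ A = Log A := by
  have h1 : LipschitzOnWith ⟨Real.exp z, (Real.exp_pos z).le⟩ Log (SPDLog m z) :=
    LipschitzOnWith.of_dist_le_mul fun A hA B hB => by
      rw [dist_eq_norm, dist_eq_norm]; exact norm_Log_sub_Log_le hz hA hB
  have h2 : LipschitzOnWith ⟨Real.exp z, (Real.exp_pos z).le⟩ Exp (symBall m z) :=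
    LipschitzOnWith.of_dist_le_mul fun A hA B hB => by
      rw [dist_eq_norm, dist_eq_norm]; exact norm_Exp_sub_Exp_le hz hA hB
  -- Globally Lipschitz extensions make compositions measurable even though functions take values in
  -- the set only almost everywhere. Both maps start from the constant `exp z`, so one `L` serves
  -- for both.
  obtain ⟨Λ, hΛ, hΛe⟩ := h1.extend_finite_dimension
  obtain ⟨E, hE, hEe⟩ := h2.extend_finite_dimension
  have hΛmem : ∀ A ∈ SPDLog m z, Λ A ∈ symBall m z := fun A hA => by
    rw [← hΛe hA]; exact Log_mem_symBall hA
  have hEmem : ∀ A ∈ symBall m z, E A ∈ SPDLog m z := fun A hA => by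
    rw [← hEe hA]; exact Exp_mem hA
  have hleft : ∀ A ∈ SPDLog m z, E (Λ A) = A := fun A hA => by
    rw [← hEe (hΛmem A hA), ← hΛe hA]; exact Exp_Log hA
  have hright : ∀ A ∈ symBall m z, Λ (E A) = A := fun A hA => by
    rw [← hΛe (hEmem A hA), ← hEe hA]; exact Log_Exp hA.1
  refine ⟨_, Λ, E, ⟨hΛ, hE, hleft, fun A hA => (hΛmem A hA).2, ?_, ?_, ?_, ?_⟩,
    fun A hA => (hΛe hA).symm⟩
  · exact fun A hA B hB => hEmem _ (midpoint_mem_symBall (hΛmem A hA) (hΛmem B hB))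
  · exact fun A hA B hB => hright _ (midpoint_mem_symBall (hΛmem A hA) (hΛmem B hB))
  -- For a limit point `A`, continuity gives `E (Λ A) = A`, and `Λ A` stays in the closed ball of
  -- symmetric matrices.
  · refine isClosed_of_closure_subset fun A hA => ?_
    obtain ⟨u, hu, hlim⟩ := mem_closure_iff_seq_limit.1 hA
    have h3 : Tendsto (fun k => Λ (u k)) atTop (𝓝 (Λ A)) := (hΛ.continuous.tendsto A).comp hlim
    have h4 : Λ A ∈ symBall m z :=
      (isClosed_symBall z).mem_of_tendsto h3 (Eventually.of_forall fun k => hΛmem _ (hu k))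
    have h5 : Tendsto (fun k => E (Λ (u k))) atTop (𝓝 (E (Λ A))) :=
      (hE.continuous.tendsto _).comp h3
    have h6 : E (Λ A) = A := tendsto_nhds_unique h5 (by
      simpa only [hleft _ (hu _)] using hlim)
    rw [← h6]
    exact hEmem _ h4
  · refine ⟨E 0, hEmem 0 ⟨?_, by simpa using hz⟩⟩
    rw [Matrix.IsHermitian.ext_iff]
    intro i j
    simp [Mat.toMatrix]

end MatrixLog

/-! ### Uniform convexity of powers of the norm -/

section UniformConvexity

variable {V : Type*} [NormedAddCommGroup V] [NormedSpace ℝ V]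

theorem norm_midpoint_rpow_le {p : ℝ} (hp : 1 ≤ p) (a b : V) :
    ‖(2⁻¹ : ℝ) • (a + b)‖ ^ p ≤ 2⁻¹ * (‖a‖ ^ p + ‖b‖ ^ p) := by
  have h1 : ‖(2⁻¹ : ℝ) • (a + b)‖ ≤ 2⁻¹ * ‖a‖ + 2⁻¹ * ‖b‖ := by
    rw [norm_smul, ← mul_add]
    have := norm_add_le a b
    norm_num
    linarith
  have h2 := (convexOn_rpow hp).2 (norm_nonneg a) (norm_nonneg b)
    (by norm_num : (0 : ℝ) ≤ 2⁻¹) (by norm_num : (0 : ℝ) ≤ 2⁻¹) (by norm_num)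
  simp only [smul_eq_mul] at h2
  calc ‖(2⁻¹ : ℝ) • (a + b)‖ ^ p ≤ (2⁻¹ * ‖a‖ + 2⁻¹ * ‖b‖) ^ p := by gcongr
    _ ≤ _ := by rw [mul_add]; exact h2

/-- For equal norms strictness comes from the strictly convex space, for different norms from the
strict convexity of `t ^ p`. -/
theorem norm_midpoint_rpow_lt [StrictConvexSpace ℝ V] {p : ℝ} (hp : 1 < p) {a b : V}
    (hab : a ≠ b) : ‖(2⁻¹ : ℝ) • (a + b)‖ ^ p < 2⁻¹ * (‖a‖ ^ p + ‖b‖ ^ p) := by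
  by_cases h : ‖a‖ = ‖b‖
  · have h1 := (norm_midpoint_lt_iff h).2 hab
    rw [one_div] at h1
    have h2 := Real.rpow_lt_rpow (norm_nonneg _) h1 (by linarith : 0 < p)
    rw [← h]
    linarith
  · have h1 : ‖(2⁻¹ : ℝ) • (a + b)‖ ≤ 2⁻¹ * ‖a‖ + 2⁻¹ * ‖b‖ := by
      rw [norm_smul, ← mul_add]
      have := norm_add_le a b
      norm_num
      linarith
    have h2 := (strictConvexOn_rpow hp).2 (norm_nonneg a) (norm_nonneg b) h
      (by norm_num : (0 : ℝ) < 2⁻¹) (by norm_num : (0 : ℝ) < 2⁻¹) (by norm_num)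
    simp only [smul_eq_mul] at h2
    calc ‖(2⁻¹ : ℝ) • (a + b)‖ ^ p ≤ (2⁻¹ * ‖a‖ + 2⁻¹ * ‖b‖) ^ p := by gcongr
      _ < _ := by rw [mul_add]; exact h2

/-- Uniform convexity of `‖·‖ ^ p` on pairs of maximum norm one. -/
theorem exists_uniform_convexity_sphere [StrictConvexSpace ℝ V] [ProperSpace V] {p : ℝ}
    (hp : 1 < p) {ε : ℝ} (hε : 0 < ε) :
    ∃ C : ℝ, 0 ≤ C ∧ ∀ a b : V, ‖(a, b)‖ = 1 →
      ‖a - b‖ ^ p + C * ‖(2⁻¹ : ℝ) • (a + b)‖ ^ p ≤ (ε + C / 2) * (‖a‖ ^ p + ‖b‖ ^ p) := by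
  have hp0 : 0 < p := by linarith
  let G : V × V → ℝ := fun q => 2⁻¹ * (‖q.1‖ ^ p + ‖q.2‖ ^ p) - ‖(2⁻¹ : ℝ) • (q.1 + q.2)‖ ^ p
  have hG : Continuous G := by
    have : Continuous fun x : ℝ => x ^ p := Real.continuous_rpow_const hp0.le
    fun_prop
  have hN : Continuous fun q : V × V => ‖q.1 - q.2‖ ^ p := by
    have : Continuous fun x : ℝ => x ^ p := Real.continuous_rpow_const hp0.le
    fun_prop
  -- On the compact set of normalized pairs that are not close, the midpoint defect `G` is positive
  -- and so has a positive lower bound `g`.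
  let T : Set (V × V) := Metric.sphere 0 1 ∩ {q | ε ≤ ‖q.1 - q.2‖ ^ p}
  have hT : IsCompact T := (isCompact_sphere 0 1).inter_right (isClosed_le continuous_const hN)
  have hpos : ∀ q ∈ T, 0 < G q := by
    rintro ⟨a, b⟩ ⟨-, h⟩
    refine sub_pos.2 (norm_midpoint_rpow_lt hp ?_)
    intro hab
    simp only [show a = b from hab, sub_self, norm_zero, Set.mem_ofPred_eq,
      Real.zero_rpow hp0.ne'] at h
    linarith
  obtain ⟨g, hg0, hg⟩ : ∃ g : ℝ, 0 < g ∧ ∀ q ∈ T, g ≤ G q := by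
    rcases T.eq_empty_or_nonempty with h | h
    · exact ⟨1, one_pos, by simp [h]⟩
    · obtain ⟨q, hq, hmin⟩ := hT.exists_isMinOn h hG.continuousOn
      exact ⟨G q, hpos q hq, fun x hx => hmin hx⟩
  -- This constant gives `‖a - b‖ ^ p ≤ 2 ^ p = C * g ≤ C * G (a, b)` on `T`. Off `T` the term with
  -- `ε` suffices, since the two powers sum to at least one.
  refine ⟨2 ^ p / g, by positivity, fun a b hab => ?_⟩
  have hsum : 1 ≤ ‖a‖ ^ p + ‖b‖ ^ p := by
    have h1 : 0 ≤ ‖a‖ ^ p := by positivity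
    have h2 : 0 ≤ ‖b‖ ^ p := by positivity
    rcases max_choice ‖a‖ ‖b‖ with h | h <;> rw [Prod.norm_mk, h] at hab <;> rw [hab] at *
      <;> simp at * <;> assumption
  have hmid := norm_midpoint_rpow_le hp.le a b
  set C := (2 : ℝ) ^ p / g with hC
  have hC0 : 0 ≤ C := by positivity
  by_cases h : ε ≤ ‖a - b‖ ^ p
  · have h1 : g ≤ G (a, b) := hg (a, b) ⟨by simpa using hab, h⟩
    have h2 : ‖a - b‖ ^ p ≤ 2 ^ p := by
      have ha : ‖a‖ ≤ 1 := hab ▸ norm_fst_le (a, b)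
      have hb : ‖b‖ ≤ 1 := hab ▸ norm_snd_le (a, b)
      have := norm_sub_le a b
      gcongr
      linarith
    have h3 : (2 : ℝ) ^ p ≤ C * G (a, b) := by
      calc (2 : ℝ) ^ p = C * g := by rw [hC]; field_simp
        _ ≤ _ := by gcongr
    have h4 : 0 ≤ ε * (‖a‖ ^ p + ‖b‖ ^ p) := by positivity
    have h5 : C * G (a, b) = C / 2 * (‖a‖ ^ p + ‖b‖ ^ p) - C * ‖(2⁻¹ : ℝ) • (a + b)‖ ^ p := by
      simp only [G]; ring
    linarith
  · have h1 : C * ‖(2⁻¹ : ℝ) • (a + b)‖ ^ p ≤ C * (2⁻¹ * (‖a‖ ^ p + ‖b‖ ^ p)) := by gcongr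
    have h2 : ε ≤ ε * (‖a‖ ^ p + ‖b‖ ^ p) := le_mul_of_one_le_right hε.le hsum
    linarith

/-- Uniform convexity of `‖·‖ ^ p` for `1 < p`. -/
theorem exists_uniform_convexity [StrictConvexSpace ℝ V] [ProperSpace V] {p : ℝ}
    (hp : 1 < p) {ε : ℝ} (hε : 0 < ε) :
    ∃ C : ℝ, 0 ≤ C ∧ ∀ a b : V,
      ‖a - b‖ ^ p + C * ‖(2⁻¹ : ℝ) • (a + b)‖ ^ p ≤ (ε + C / 2) * (‖a‖ ^ p + ‖b‖ ^ p) := by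
  have hp0 : 0 < p := by linarith
  obtain ⟨C, hC, h⟩ := exists_uniform_convexity_sphere (V := V) hp hε
  refine ⟨C, hC, fun a b => ?_⟩
  by_cases h0 : ‖(a, b)‖ = 0
  · obtain ⟨rfl, rfl⟩ : a = 0 ∧ b = 0 := Prod.mk_eq_zero.1 (norm_eq_zero.1 h0)
    simp [Real.zero_rpow hp0.ne']
  set t := ‖(a, b)‖ with ht
  have ht0 : 0 < t := lt_of_le_of_ne (norm_nonneg _) (Ne.symm h0)
  -- All terms are homogeneous of degree `p`, so a general pair is scaled to maximum norm one.
  have h1 := h (t⁻¹ • a) (t⁻¹ • b) (by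
    rw [← Prod.smul_mk, norm_smul, ← ht, Real.norm_eq_abs, abs_of_pos (inv_pos.2 ht0),
      inv_mul_cancel₀ h0])
  rw [← smul_sub, ← smul_add, smul_comm (2⁻¹ : ℝ)] at h1
  have hs : ∀ c : V, ‖t⁻¹ • c‖ ^ p = (t ^ p)⁻¹ * ‖c‖ ^ p := fun c => by
    rw [norm_smul, Real.mul_rpow (norm_nonneg _) (norm_nonneg _), Real.norm_eq_abs,
      abs_of_pos (inv_pos.2 ht0), Real.inv_rpow ht0.le]
  simp only [hs] at h1
  have htp : 0 < t ^ p := by positivity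
  have h2 := mul_le_mul_of_nonneg_left h1 htp.le
  have e : t ^ p * (t ^ p)⁻¹ = 1 := mul_inv_cancel₀ htp.ne'
  calc ‖a - b‖ ^ p + C * ‖(2⁻¹ : ℝ) • (a + b)‖ ^ p
      = (t ^ p * (t ^ p)⁻¹) * (‖a - b‖ ^ p + C * ‖(2⁻¹ : ℝ) • (a + b)‖ ^ p) := by rw [e, one_mul]
    _ ≤ (t ^ p * (t ^ p)⁻¹) * ((ε + C / 2) * (‖a‖ ^ p + ‖b‖ ^ p)) := by linarith
    _ = _ := by rw [e, one_mul]

end UniformConvexity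

/-! ### Powers of `L^p` norms: Fatou, Lipschitz maps, convexity -/

section LpPow

variable {X : Type*} [MeasurableSpace X] {V : Type*} [NormedAddCommGroup V]

/-- The `p`-th power of the `L^p` norm. -/
noncomputable def lpPow (p : ℝ) (μ : Measure X) (f : X → V) : ℝ≥0∞ := ∫⁻ x, ‖f x‖ₑ ^ p ∂μ

variable {p : ℝ} {μ : Measure X}

theorem eLpNorm_rpow_eq_lpPow (hp : 0 < p) (f : X → V) :
    eLpNorm f (ENNReal.ofReal p) μ ^ p = lpPow p μ f := by
  rw [eLpNorm_eq_lintegral_rpow_enorm_toReal (by simpa using hp) ENNReal.ofReal_ne_top,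
    ENNReal.toReal_ofReal hp.le, ← ENNReal.rpow_mul, one_div, inv_mul_cancel₀ hp.ne',
    ENNReal.rpow_one, lpPow]

theorem lpPow_lt_top_iff (hp : 0 < p) (f : X → V) :
    lpPow p μ f < ⊤ ↔ eLpNorm f (ENNReal.ofReal p) μ < ⊤ := by
  rw [← eLpNorm_rpow_eq_lpPow hp, ENNReal.rpow_lt_top_iff_of_pos hp]

theorem tendsto_lpPow_zero_iff (hp : 0 < p) {ι : Type*} {F : Filter ι} (f : ι → X → V) :
    Tendsto (fun i => lpPow p μ (f i)) F (𝓝 0) ↔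
      Tendsto (fun i => eLpNorm (f i) (ENNReal.ofReal p) μ) F (𝓝 0) := by
  simp only [← eLpNorm_rpow_eq_lpPow hp]
  constructor
  · intro h
    have := (ENNReal.continuous_rpow_const (y := p⁻¹)).tendsto (0 : ℝ≥0∞) |>.comp h
    simpa [Function.comp_def, ← ENNReal.rpow_mul, mul_inv_cancel₀ hp.ne', hp] using this
  · intro h
    have := (ENNReal.continuous_rpow_const (y := p)).tendsto (0 : ℝ≥0∞) |>.comp h
    simpa [Function.comp_def, hp] using this

theorem lpPow_mono_measure {ν : Measure X} (h : ν ≤ μ) (f : X → V) : lpPow p ν f ≤ lpPow p μ f :=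
  lintegral_mono' h le_rfl

theorem lpPow_congr {f g : X → V} (h : f =ᵐ[μ] g) : lpPow p μ f = lpPow p μ g :=
  lintegral_congr_ae (h.mono fun x hx => by simp only [hx])

theorem lpPow_eq_zero_iff (hp : 0 < p) {f : X → V} (hf : AEStronglyMeasurable f μ) :
    lpPow p μ f = 0 ↔ f =ᵐ[μ] 0 := by
  rw [lpPow, lintegral_eq_zero_iff' (hf.enorm.pow_const p)]
  refine eventually_congr (Eventually.of_forall fun x => ?_)
  simp [hp]

/-- Fatou's lemma for the `p`-th power of the `L^p` norm. -/
theorem lpPow_le_liminf {f : ℕ → X → V} {g : X → V}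
    (hf : ∀ k, AEStronglyMeasurable (f k) μ)
    (hlim : ∀ᵐ x ∂μ, Tendsto (fun k => f k x) atTop (𝓝 (g x))) :
    lpPow p μ g ≤ liminf (fun k => lpPow p μ (f k)) atTop := by
  refine le_trans (lintegral_mono_ae ?_) (lintegral_liminf_le' fun k => (hf k).enorm.pow_const p)
  filter_upwards [hlim] with x hx
  have := ((ENNReal.continuous_rpow_const (y := p)).tendsto _).comp hx.enorm
  exact this.liminf_eq.ge

theorem lpPow_add_le (hp : 1 ≤ p) {f g : X → V} (hf : AEStronglyMeasurable f μ) :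
    lpPow p μ (f + g) ≤ 2 ^ (p - 1) * (lpPow p μ f + lpPow p μ g) := by
  rw [lpPow, lpPow, lpPow, ← lintegral_add_left' (hf.enorm.pow_const p),
    ← lintegral_const_mul' _ _ (by
      exact ENNReal.rpow_ne_top_of_nonneg (by linarith) (by simp))]
  refine lintegral_mono fun x => ?_
  calc ‖f x + g x‖ₑ ^ p ≤ (‖f x‖ₑ + ‖g x‖ₑ) ^ p := by
        gcongr
        exact enorm_add_le _ _
    _ ≤ _ := ENNReal.rpow_add_le_mul_rpow_add_rpow _ _ hp

theorem lpPow_lipschitz_comp_le (hp : 0 ≤ p) {L : NNReal} {f g : X → V}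
    {W : Type*} [NormedAddCommGroup W] {f' g' : X → W}
    (h : ∀ᵐ x ∂μ, ‖f' x - g' x‖ ≤ L * ‖f x - g x‖) :
    lpPow p μ (f' - g') ≤ (L : ℝ≥0∞) ^ p * lpPow p μ (f - g) := by
  rw [lpPow, lpPow, ← lintegral_const_mul' _ _ (by
      exact ENNReal.rpow_ne_top_of_nonneg hp (by simp))]
  refine lintegral_mono_ae (h.mono fun x hx => ?_)
  rw [← ENNReal.mul_rpow_of_nonneg _ _ hp]
  gcongr
  simp only [Pi.sub_apply, enorm_eq_nnnorm]
  exact_mod_cast hx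

/-- Uniform convexity of `L^p`. -/
theorem exists_lpPow_uniform_convexity [NormedSpace ℝ V] [StrictConvexSpace ℝ V] [ProperSpace V]
    (hp : 1 < p) {ε : NNReal} (hε : 0 < ε) :
    ∃ C : NNReal, ∀ {X : Type _} [MeasurableSpace X] (μ : Measure X) (f g : X → V),
      AEStronglyMeasurable f μ → AEStronglyMeasurable g μ →
      lpPow p μ (f - g) + C * lpPow p μ ((2⁻¹ : ℝ) • (f + g)) ≤
        (ε + C / 2) * (lpPow p μ f + lpPow p μ g) := by
  have hp0 : 0 ≤ p := by linarith
  obtain ⟨C, hC, h⟩ := exists_uniform_convexity (V := V) hp (NNReal.coe_pos.2 hε)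
  lift C to NNReal using hC
  refine ⟨C, fun μ f g hf hg => ?_⟩
  have h' : ∀ a b : V, ‖a - b‖ₑ ^ p + C * ‖(2⁻¹ : ℝ) • (a + b)‖ₑ ^ p ≤
      (ε + C / 2) * (‖a‖ₑ ^ p + ‖b‖ₑ ^ p) := by
    intro a b
    have h1 : ‖a - b‖₊ ^ p + C * ‖(2⁻¹ : ℝ) • (a + b)‖₊ ^ p ≤
      (ε + C / 2) * (‖a‖₊ ^ p + ‖b‖₊ ^ p) := by
      have := h a b
      exact_mod_cast this
    have h2 := ENNReal.coe_le_coe.2 h1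
    simp only [enorm_eq_nnnorm, ← ENNReal.coe_rpow_of_nonneg _ hp0]
    push_cast at h2 ⊢
    exact h2
  simp only [lpPow]
  rw [← lintegral_const_mul' _ _ ENNReal.coe_ne_top,
    ← lintegral_add_left' ((hf.sub hg).enorm.pow_const p),
    ← lintegral_add_left' (hf.enorm.pow_const p),
    ← lintegral_const_mul' _ _ (by finiteness)]
  exact lintegral_mono fun x => h' (f x) (g x)

/-- Strict convexity of `L^p`. -/
theorem ae_eq_of_lpPow_midpoint [NormedSpace ℝ V] [StrictConvexSpace ℝ V] [ProperSpace V]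
    (hp : 1 < p) {f g : X → V} (hf : AEStronglyMeasurable f μ) (hg : AEStronglyMeasurable g μ)
    (hfin : lpPow p μ f < ⊤) (hfg : lpPow p μ g = lpPow p μ f)
    (hmid : lpPow p μ f ≤ lpPow p μ ((2⁻¹ : ℝ) • (f + g))) : f =ᵐ[μ] g := by
  -- The norms are equal and the midpoint is no smaller, so the terms with `C` cancel in the uniform
  -- convexity inequality and only the one with `ε` remains.
  have key : ∀ ε : NNReal, 0 < ε → lpPow p μ (f - g) ≤ ε * (2 * lpPow p μ f) := by
    intro ε hε
    obtain ⟨C, hC⟩ := exists_lpPow_uniform_convexity (V := V) hp hε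
    have h := hC μ f g hf hg
    rw [hfg, ← two_mul] at h
    have h1 : lpPow p μ (f - g) + C * lpPow p μ f ≤
        ε * (2 * lpPow p μ f) + C * lpPow p μ f := by
      calc _ ≤ _ := by gcongr
        _ ≤ _ := h
        _ = _ := by
          rw [add_mul, ← mul_assoc (C / 2 : ℝ≥0∞), ENNReal.div_mul_cancel two_ne_zero (by simp)]
    exact (ENNReal.add_le_add_iff_right (by finiteness)).1 h1
  have h0 : lpPow p μ (f - g) = 0 := by
    obtain ⟨A, hA⟩ := WithTop.ne_top_iff_exists.1 (show 2 * lpPow p μ f ≠ ⊤ by finiteness)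
    have h2 : Tendsto (fun n : ℕ => (((n : NNReal) + 1)⁻¹ * A : NNReal)) atTop (𝓝 (0 * A)) := by
      refine Tendsto.mul_const _ ?_
      have := tendsto_one_div_add_atTop_nhds_zero_nat (𝕜 := NNReal)
      simpa using this
    rw [zero_mul] at h2
    refine le_antisymm (ge_of_tendsto' (ENNReal.tendsto_coe.2 h2) fun n => ?_) zero_le
    have := key (((n : NNReal) + 1)⁻¹) (by positivity)
    rw [← hA] at this
    exact_mod_cast this
  have := (lpPow_eq_zero_iff (by linarith) (hf.sub hg)).1 h0
  filter_upwards [this] with x hx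
  exact sub_eq_zero.1 hx

end LpPow

/-! ### Convex combinations of tails -/

/-- In a uniformly convex situation, a bounded sequence whose tail convex hulls can only converge
to zero has convex combinations of its tails tending to zero. -/
theorem exists_convex_combinations_tendsto_zero {X : Type*} [AddCommGroup X] [Module ℝ X]
    (P : X → ℝ) (hP : ∀ x, 0 ≤ P x)
    (hUC : ∀ ε : ℝ, 0 < ε → ∃ C : ℝ, 0 ≤ C ∧ ∀ x y,
      P (x - y) + C * P ((2⁻¹ : ℝ) • (x + y)) ≤ (ε + C / 2) * (P x + P y))
    (v : ℕ → X) (M : ℝ) (hM : ∀ k, P (v k) ≤ M)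
    (hF : ∀ x : ℕ → X, (∀ N, x N ∈ convexHull ℝ (v '' Set.Ici N)) → ∀ (y : X) (c : ℝ),
      (∀ᶠ N in atTop, P (y - x N) ≤ c) → P y ≤ c) :
    ∃ x : ℕ → X, (∀ N, x N ∈ convexHull ℝ (v '' Set.Ici N)) ∧
      Tendsto (fun N => P (x N)) atTop (𝓝 0) := by
  let S : ℕ → Set X := fun N => convexHull ℝ (v '' Set.Ici N)
  have hSanti : ∀ {N N'}, N ≤ N' → S N' ⊆ S N := fun h =>
    convexHull_mono (Set.image_mono (Set.Ici_subset_Ici.2 h))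
  have hvS : ∀ N, v N ∈ S N := fun N =>
    subset_convexHull ℝ _ ⟨N, Set.self_mem_Ici, rfl⟩
  -- The infima over the hulls of the tails increase to a finite limit `D`, because the hulls shrink
  -- and the sequence is bounded. The `x N` chosen below are near minimizers.
  let d : ℕ → ℝ := fun N => sInf (P '' S N)
  have hbdd : ∀ N, BddBelow (P '' S N) := fun N => ⟨0, by rintro _ ⟨x, -, rfl⟩; exact hP x⟩
  have hd_le : ∀ N x, x ∈ S N → d N ≤ P x := fun N x hx => csInf_le (hbdd N) ⟨x, hx, rfl⟩
  have hdM : ∀ N, d N ≤ M := fun N => (hd_le N _ (hvS N)).trans (hM N)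
  have hdmono : Monotone d := fun N N' h =>
    csInf_le_csInf (hbdd N) ⟨_, v N', hvS N', rfl⟩ (Set.image_mono (hSanti h))
  have hbdd' : BddAbove (Set.range d) := ⟨M, by rintro _ ⟨N, rfl⟩; exact hdM N⟩
  have hdlim := tendsto_atTop_ciSup hdmono hbdd'
  set D := ⨆ N, d N with hD
  have hdD : ∀ N, d N ≤ D := fun N => le_ciSup hbdd' N
  have hDM : D ≤ M := ciSup_le hdM
  have hex : ∀ N : ℕ, ∃ x ∈ S N, P x < d N + 1 / ((N : ℝ) + 1) := by
    intro N
    obtain ⟨_, ⟨x, hx, rfl⟩, h⟩ := exists_lt_of_csInf_lt (s := P '' S N) ⟨_, v N, hvS N, rfl⟩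
      (show sInf (P '' S N) < d N + 1 / ((N : ℝ) + 1) from lt_add_of_pos_right _ (by positivity))
    exact ⟨x, hx, h⟩
  choose x hxS hxP using hex
  refine ⟨x, hxS, ?_⟩
  have hM0 : 0 ≤ M := (hP _).trans (hM 0)
  -- For `N' ≥ N` the midpoint of `x N` and `x N'` lies in `S N`, so its value is at least `d N`.
  -- Uniform convexity then bounds `P (x N - x N')` uniformly in `N'`, and `hF` with `y = x N`
  -- passes this bound on to `P (x N)` itself.
  have hbound : ∀ ε : ℝ, 0 < ε → ∃ C : ℝ, 0 ≤ C ∧ ∀ N : ℕ,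
      P (x N) ≤ 2 * ε * (M + 1) + C * (D - d N + 1 / ((N : ℝ) + 1)) := by
    intro ε hε
    obtain ⟨C, hC, h⟩ := hUC ε hε
    refine ⟨C, hC, fun N => hF x hxS (x N) _ ?_⟩
    filter_upwards [eventually_ge_atTop N] with N' hN
    have h1 := h (x N) (x N')
    have h2 : (2⁻¹ : ℝ) • (x N + x N') ∈ S N := by
      rw [smul_add]
      exact (convex_convexHull ℝ _) (hxS N) (hSanti hN (hxS N')) (by norm_num) (by norm_num)
        (by norm_num)
    have h3 := mul_le_mul_of_nonneg_left (hd_le N _ h2) hC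
    have hN1 : 1 / ((N' : ℝ) + 1) ≤ 1 / ((N : ℝ) + 1) := by gcongr
    have hN2 : 1 / ((N : ℝ) + 1) ≤ 1 := by
      rw [div_le_one (by positivity)]; linarith [(Nat.cast_nonneg N : (0 : ℝ) ≤ N)]
    have h4 : P (x N) + P (x N') ≤ 2 * (M + 1) := by
      linarith [hxP N, hxP N', hdM N, hdM N']
    have h5 : P (x N) + P (x N') ≤ 2 * D + 2 * (1 / ((N : ℝ) + 1)) := by
      linarith [hxP N, hxP N', hdD N, hdD N']
    have h6 := mul_le_mul_of_nonneg_left h4 hε.le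
    have h7 := mul_le_mul_of_nonneg_left h5 (by positivity : 0 ≤ C / 2)
    have h8 : C * (d N) ≤ C * P ((2⁻¹ : ℝ) • (x N + x N')) := h3
    nlinarith
  rw [Metric.tendsto_atTop]
  intro ε hε
  obtain ⟨C, hC, h⟩ := hbound (ε / (4 * (M + 1))) (by positivity)
  have hlim : Tendsto (fun N : ℕ => C * (D - d N + 1 / ((N : ℝ) + 1))) atTop (𝓝 0) := by
    have h1 : Tendsto (fun N : ℕ => C * (D - d N + 1 / ((N : ℝ) + 1))) atTop
        (𝓝 (C * (D - D + 0))) :=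
      ((tendsto_const_nhds.sub hdlim).add tendsto_one_div_add_atTop_nhds_zero_nat).const_mul C
    simpa using h1
  obtain ⟨N0, hN0⟩ := eventually_atTop.1 (hlim.eventually_lt_const (half_pos hε))
  refine ⟨N0, fun N hN => ?_⟩
  rw [Real.dist_eq, sub_zero, abs_of_nonneg (hP _)]
  have h1 := h N
  have h2 := hN0 N hN
  have h3 : 2 * (ε / (4 * (M + 1))) * (M + 1) = ε / 2 := by field_simp; norm_num
  linarith

/-! ### Difference quotients and weak convergence in `W^{s,p}` -/

section Wsp

variable {n m : ℕ} {Ω : Set (Space n)} {s p : ℝ}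

/-- The vector-valued difference quotient. -/
noncomputable def diffVec (s p : ℝ) (w : Space n → Mat m) (q : Space n × Space n) : Mat m :=
  (‖q.1 - q.2‖ ^ ((n : ℝ) / p + s))⁻¹ • (w q.1 - w q.2)

theorem norm_diffVec (w : Space n → Mat m) (q : Space n × Space n) :
    ‖diffVec s p w q‖ = diffQuot s p w q := by
  rw [diffVec, diffQuot, norm_smul, Real.norm_eq_abs, abs_of_nonneg (by positivity)]
  ring

theorem diffVec_sub (u v : Space n → Mat m) :
    diffVec s p (u - v) = diffVec s p u - diffVec s p v := by
  funext q
  simp only [diffVec, Pi.sub_apply, ← smul_sub]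
  congr 1
  abel

theorem diffVec_add (u v : Space n → Mat m) :
    diffVec s p (u + v) = diffVec s p u + diffVec s p v := by
  funext q
  simp only [diffVec, Pi.add_apply, ← smul_add]
  congr 1
  abel

theorem diffVec_smul (c : ℝ) (u : Space n → Mat m) :
    diffVec s p (c • u) = c • diffVec s p u := by
  funext q
  simp only [diffVec, Pi.smul_apply, ← smul_sub]
  rw [smul_comm]

theorem aestronglyMeasurable_diffVec {w : Space n → Mat m}
    (hw : AEStronglyMeasurable w (volume.restrict Ω)) :
    AEStronglyMeasurable (diffVec s p w) (volSq Ω) := by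
  have h2 : Measurable fun q : Space n × Space n => (‖q.1 - q.2‖ ^ ((n : ℝ) / p + s))⁻¹ := by
    fun_prop
  exact h2.aestronglyMeasurable.smul (hw.comp_fst.sub hw.comp_snd)

theorem lpPow_diffQuot (μ : Measure (Space n × Space n)) (w : Space n → Mat m) :
    lpPow p μ (diffQuot s p w) = lpPow p μ (diffVec s p w) := by
  refine lintegral_congr fun q => ?_
  rw [← norm_diffVec, enorm_norm]

theorem mem_Wsp_iff (hp : 0 < p) {w : Space n → Mat m} :
    w ∈ Wsp m Ω s p ↔ AEStronglyMeasurable w (volume.restrict Ω) ∧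
      lpPow p (volume.restrict Ω) w < ⊤ ∧ lpPow p (volSq Ω) (diffVec s p w) < ⊤ := by
  rw [← lpPow_diffQuot, lpPow_lt_top_iff hp, lpPow_lt_top_iff hp]
  constructor
  · rintro ⟨h1, h2⟩
    exact ⟨h1.1, h1.2, h2.2⟩
  · rintro ⟨h1, h2, h3⟩
    exact ⟨⟨h1, h2⟩, aestronglyMeasurable_diffQuot h1, h3⟩

theorem wspNorm_eq (hp : 0 < p) (w : Space n → Mat m) :
    wspNorm Ω s p w = ((lpPow p (volume.restrict Ω) w).toReal +
      (lpPow p (volSq Ω) (diffVec s p w)).toReal) ^ (1 / p) := by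
  rw [wspNorm, ENNReal.toReal_rpow, ENNReal.toReal_rpow, eLpNorm_rpow_eq_lpPow hp,
    eLpNorm_rpow_eq_lpPow hp, lpPow_diffQuot]

theorem ae_volSq_of_ae {Q : Space n → Prop} (h : ∀ᵐ x ∂(volume.restrict Ω), Q x) :
    ∀ᵐ q ∂(volSq Ω), Q q.1 ∧ Q q.2 :=
  (Measure.quasiMeasurePreserving_fst.ae h).and (Measure.quasiMeasurePreserving_snd.ae h)

theorem tendsto_diffVec {u : ℕ → Space n → Mat m} {w : Space n → Mat m}
    (h : ∀ᵐ x ∂(volume.restrict Ω), Tendsto (fun k => u k x) atTop (𝓝 (w x))) :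
    ∀ᵐ q ∂(volSq Ω), Tendsto (fun k => diffVec s p (u k) q) atTop (𝓝 (diffVec s p w q)) := by
  filter_upwards [ae_volSq_of_ae h] with q hq
  exact (hq.1.sub hq.2).const_smul _

theorem exists_subseq_ae_of_tendsto_lpPow {X : Type*} [MeasurableSpace X] {μ : Measure X}
    {V : Type*} [NormedAddCommGroup V] (hp : 0 < p) {u : ℕ → X → V} {w : X → V}
    (hu : ∀ k, AEStronglyMeasurable (u k) μ) (hw : AEStronglyMeasurable w μ)
    (h : Tendsto (fun k => lpPow p μ (u k - w)) atTop (𝓝 0)) :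
    ∃ φ : ℕ → ℕ, StrictMono φ ∧ ∀ᵐ x ∂μ, Tendsto (fun k => u (φ k) x) atTop (𝓝 (w x)) :=
  (tendstoInMeasure_of_tendsto_eLpNorm (by simpa using hp) hu hw
    ((tendsto_lpPow_zero_iff hp _).1 h)).exists_seq_tendsto_ae

/-- Balls of the `L^p` norm are convex: one that contains a tail contains its convex hull. -/
theorem Wsp.lpPow_tendsto_zero_of_convexHull (hp : 1 < p) {v : ℕ → Wsp m Ω s p}
    (hv : Tendsto (fun k => lpPow p (volume.restrict Ω) (v k : Space n → Mat m)) atTop (𝓝 0))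
    {x : ℕ → Wsp m Ω s p} (hx : ∀ N, x N ∈ convexHull ℝ (v '' Set.Ici N)) :
    Tendsto (fun k => lpPow p (volume.restrict Ω) (x k : Space n → Mat m)) atTop (𝓝 0) := by
  have hp0 : 0 < p := by linarith
  rw [tendsto_lpPow_zero_iff hp0] at hv ⊢
  rw [ENNReal.tendsto_nhds_zero] at hv ⊢
  intro ε hε
  obtain ⟨N0, hN0⟩ := eventually_atTop.1 (hv ε hε)
  filter_upwards [eventually_ge_atTop N0] with N hN
  let B : Set (Wsp m Ω s p) :=
    {y | eLpNorm (y : Space n → Mat m) (ENNReal.ofReal p) (volume.restrict Ω) ≤ ε}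
  have hB : Convex ℝ B := by
    intro y hy y' hy' a b ha hb hab
    have h1 := (eLpNorm_add_le (y.2.1.1.const_smul a) (y'.2.1.1.const_smul b)
      (p := ENNReal.ofReal p) (by simpa using hp.le) : eLpNorm (a • (y : Space n → Mat m) +
        b • (y' : Space n → Mat m)) _ (volume.restrict Ω) ≤ _)
    refine h1.trans ?_
    rw [eLpNorm_const_smul, eLpNorm_const_smul]
    calc _ ≤ ‖a‖ₑ * ε + ‖b‖ₑ * ε := by
          gcongr
          · exact hy
          · exact hy'
      _ = ENNReal.ofReal (a + b) * ε := by
          rw [Real.enorm_of_nonneg ha, Real.enorm_of_nonneg hb, ENNReal.ofReal_add ha hb, add_mul]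
      _ = ε := by rw [hab]; simp
  have hsub : v '' Set.Ici N ⊆ B := by
    rintro _ ⟨k, hk, rfl⟩
    exact hN0 k (hN.trans hk)
  exact convexHull_min hsub hB (hx N)

/-- A sequence bounded in `W^{s,p}` which converges to zero in `L^p` is annihilated in the limit by
every bounded functional. -/
theorem Wsp.tendsto_functional_zero (hp : 1 < p) {v : ℕ → Wsp m Ω s p}
    (hv : Tendsto (fun k => lpPow p (volume.restrict Ω) (v k : Space n → Mat m)) atTop (𝓝 0))
    {M : ℝ} (hM : ∀ k, (lpPow p (volSq Ω) (diffVec s p (v k : Space n → Mat m))).toReal ≤ M)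
    (f : Wsp m Ω s p →ₗ[ℝ] ℝ)
    (hf : ∃ C : ℝ, ∀ v : Wsp m Ω s p, |f v| ≤ C * wspNorm Ω s p (v : Space n → Mat m)) :
    Tendsto (fun k => f (v k)) atTop (𝓝 0) := by
  have hp0 : 0 < p := by linarith
  -- A one-sided estimate is enough, since it applies to `f` and to `-f`. If it failed, `f ≥ ε`
  -- would hold along a subsequence, hence on the convex hulls of its tails, and these contain
  -- elements of arbitrarily small norm.
  have upper : ∀ {v : ℕ → Wsp m Ω s p},
      Tendsto (fun k => lpPow p (volume.restrict Ω) (v k : Space n → Mat m)) atTop (𝓝 0) →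
      (∀ k, (lpPow p (volSq Ω) (diffVec s p (v k : Space n → Mat m))).toReal ≤ M) →
      ∀ (f : Wsp m Ω s p →ₗ[ℝ] ℝ),
      (∃ C : ℝ, ∀ v : Wsp m Ω s p, |f v| ≤ C * wspNorm Ω s p (v : Space n → Mat m)) →
      ∀ ε : ℝ, 0 < ε → ∀ᶠ k in atTop, f (v k) < ε := by
    intro v hv hM f hf ε hε
    by_contra hcon
    rw [not_eventually] at hcon
    simp only [not_lt] at hcon
    obtain ⟨φ, hφ, hfφ⟩ := extraction_of_frequently_atTop hcon
    let P : Wsp m Ω s p → ℝ := fun u =>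
      (lpPow p (volSq Ω) (diffVec s p (u : Space n → Mat m))).toReal
    have hfin : ∀ u : Wsp m Ω s p,
        lpPow p (volSq Ω) (diffVec s p (u : Space n → Mat m)) ≠ ⊤ := fun u =>
      ((mem_Wsp_iff hp0).1 u.2).2.2.ne
    have hmeas : ∀ u : Wsp m Ω s p, AEStronglyMeasurable (u : Space n → Mat m)
      (volume.restrict Ω) := fun u => u.2.1.1
    have hvφ := hv.comp hφ.tendsto_atTop
    have hUC : ∀ ε : ℝ, 0 < ε → ∃ C : ℝ, 0 ≤ C ∧ ∀ x y,
        P (x - y) + C * P ((2⁻¹ : ℝ) • (x + y)) ≤ (ε + C / 2) * (P x + P y) := by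
      intro ε hε
      lift ε to NNReal using hε.le
      obtain ⟨C, hC⟩ := exists_lpPow_uniform_convexity (V := Mat m) hp (NNReal.coe_pos.1 hε)
      refine ⟨C, C.2, fun x y => ?_⟩
      have h := hC (volSq Ω) (diffVec s p (x : Space n → Mat m)) (diffVec s p (y : Space n → Mat m))
        (aestronglyMeasurable_diffVec (hmeas x)) (aestronglyMeasurable_diffVec (hmeas y))
      rw [← diffVec_sub, ← diffVec_add, ← diffVec_smul] at h
      have h1 := hfin (x - y)
      have h2 := hfin ((2⁻¹ : ℝ) • (x + y))
      have h3 := hfin x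
      have h4 := hfin y
      simp only [P]
      simp only [Submodule.coe_sub, Submodule.coe_smul, Submodule.coe_add] at h1 h2 ⊢
      have h' := ENNReal.toReal_mono (by finiteness) h
      rw [ENNReal.toReal_add h1 (by finiteness), ENNReal.toReal_mul, ENNReal.toReal_mul,
        ENNReal.toReal_add h3 h4, ENNReal.toReal_add (by finiteness) (by finiteness),
        ENNReal.toReal_div] at h'
      simpa using h'
    -- The convex combinations tend to zero in `L^p`, hence a.e. along a subsequence, and Fatou's
    -- lemma for the difference quotients applies.
    have hF : ∀ x : ℕ → Wsp m Ω s p, (∀ N, x N ∈ convexHull ℝ ((v ∘ φ) '' Set.Ici N)) →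
        ∀ (y : Wsp m Ω s p) (c : ℝ), (∀ᶠ N in atTop, P (y - x N) ≤ c) → P y ≤ c := by
      intro x hx y c hc
      have hxL := Wsp.lpPow_tendsto_zero_of_convexHull hp (v := v ∘ φ) hvφ hx
      obtain ⟨ψ, hψ, hae⟩ := exists_subseq_ae_of_tendsto_lpPow hp0 (w := (0 : Space n → Mat m))
        (fun k => hmeas (x k)) aestronglyMeasurable_const (by simpa using hxL)
      have hae' : ∀ᵐ t ∂(volume.restrict Ω),
          Tendsto (fun k => ((y - x (ψ k) : Wsp m Ω s p) : Space n → Mat m) t) atTop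
            (𝓝 ((y : Space n → Mat m) t)) := by
        filter_upwards [hae] with t ht
        simpa using (tendsto_const_nhds (x := (y : Space n → Mat m) t)).sub ht
      have hFat := lpPow_le_liminf (p := p)
        (fun k => aestronglyMeasurable_diffVec (s := s) (p := p) (hmeas (y - x (ψ k))))
        (tendsto_diffVec (s := s) (p := p) hae')
      have hc0 : 0 ≤ c := by
        obtain ⟨N, hN⟩ := hc.exists
        exact ENNReal.toReal_nonneg.trans hN
      refine ENNReal.toReal_le_of_le_ofReal hc0 (hFat.trans ?_)
      refine liminf_le_of_frequently_le' (Eventually.frequently ?_)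
      filter_upwards [hψ.tendsto_atTop.eventually hc] with k hk
      exact (ENNReal.le_ofReal_iff_toReal_le (hfin _) hc0).2 hk
    obtain ⟨x, hx, hx0⟩ := exists_convex_combinations_tendsto_zero P
      (fun _ => ENNReal.toReal_nonneg) hUC (v ∘ φ) M (fun k => hM (φ k)) hF
    have hxL := Wsp.lpPow_tendsto_zero_of_convexHull hp (v := v ∘ φ) hvφ hx
    obtain ⟨C, hC⟩ := hf
    have hge : ∀ N, ε ≤ f (x N) := by
      intro N
      have hconv : Convex ℝ {y | ε ≤ f y} := convex_halfSpace_ge f.isLinear ε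
      have hsub : (v ∘ φ) '' Set.Ici N ⊆ {y | ε ≤ f y} := by
        rintro _ ⟨k, -, rfl⟩
        exact hfφ k
      exact convexHull_min hsub hconv (hx N)
    have hnorm : Tendsto (fun N => C * wspNorm Ω s p (x N : Space n → Mat m)) atTop (𝓝 0) := by
      have h1 := ((ENNReal.tendsto_toReal ENNReal.zero_ne_top).comp hxL).add hx0
      have h2 := (((Real.continuous_rpow_const (by positivity : 0 ≤ 1 / p)).tendsto _).comp
        h1).const_mul C
      simp only [wspNorm_eq hp0]
      simpa [Function.comp_def, P, Real.zero_rpow (inv_ne_zero hp0.ne')] using h2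
    have := ge_of_tendsto' hnorm fun N => (hge N).trans ((le_abs_self _).trans (hC (x N)))
    linarith
  rw [Metric.tendsto_nhds]
  intro ε hε
  filter_upwards [upper hv hM f hf ε hε, upper hv hM (-f) (by simpa using hf) ε hε] with k h1 h2
  rw [Real.dist_eq, sub_zero, abs_lt]
  simp only [LinearMap.neg_apply] at h2
  constructor <;> linarith

/-- Boundedness in `W^{s,p}` and convergence in `L^p` imply weak convergence in `W^{s,p}`. -/
theorem weakTendsto_of_tendsto_lpPow (hp : 1 < p) {u : ℕ → Space n → Mat m} {w : Space n → Mat m}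
    (hu : ∀ k, u k ∈ Wsp m Ω s p) (hw : w ∈ Wsp m Ω s p)
    (hlim : Tendsto (fun k => lpPow p (volume.restrict Ω) (u k - w)) atTop (𝓝 0))
    {M : ℝ≥0∞} (hMtop : M ≠ ⊤) (hM : ∀ k, lpPow p (volSq Ω) (diffVec s p (u k)) ≤ M) :
    WeakTendsto Ω s p u w := by
  refine ⟨hu, hw, fun f hf => ?_⟩
  have hp0 : 0 < p := by linarith
  have hw3 := ((mem_Wsp_iff hp0).1 hw).2.2
  let v : ℕ → Wsp m Ω s p := fun k => ⟨u k, hu k⟩ - ⟨w, hw⟩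
  have hb : ∀ k, lpPow p (volSq Ω) (diffVec s p (v k : Space n → Mat m)) ≤
      2 ^ (p - 1) * (M + lpPow p (volSq Ω) (diffVec s p w)) := by
    intro k
    have h1 : diffVec s p (v k : Space n → Mat m) = diffVec s p (u k) + diffVec s p (-w) := by
      rw [← diffVec_add, ← sub_eq_add_neg]
      rfl
    have h2 : lpPow p (volSq Ω) (diffVec s p (-w)) = lpPow p (volSq Ω) (diffVec s p w) := by
      rw [← neg_one_smul ℝ w, diffVec_smul, neg_one_smul]
      exact lintegral_congr fun q => by simp
    rw [h1, ← h2]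
    refine (lpPow_add_le hp.le (aestronglyMeasurable_diffVec (hu k).1.1)).trans ?_
    gcongr
    exact hM k
  have htop : (2 : ℝ≥0∞) ^ (p - 1) * (M + lpPow p (volSq Ω) (diffVec s p w)) ≠ ⊤ :=
    ENNReal.mul_ne_top (ENNReal.rpow_ne_top_of_nonneg (by linarith) (by simp)) (by finiteness)
  have := Wsp.tendsto_functional_zero hp (v := v) hlim
    (fun k => ENNReal.toReal_mono htop (hb k)) f hf
  simpa [v, map_sub, tendsto_sub_nhds_zero_iff] using this

/-- Weak limits in `W^{s,p}` are unique almost everywhere. -/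
theorem WeakTendsto.ae_unique (hp : 1 < p) (hΩ : volume Ω ≠ ⊤) {u : ℕ → Space n → Mat m}
    {w w' : Space n → Mat m} (h : WeakTendsto Ω s p u w) (h' : WeakTendsto Ω s p u w') :
    w =ᵐ[volume.restrict Ω] w' := by
  have hp0 : 0 < p := by linarith
  obtain ⟨hu, hw, hlim⟩ := h
  obtain ⟨_, hw', hlim'⟩ := h'
  have : IsFiniteMeasure (volume.restrict Ω) := ⟨by simpa using hΩ.lt_top⟩
  have hp1 : (1 : ℝ≥0∞) ≤ ENNReal.ofReal p := by simpa using hp.le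
  have hinteg : ∀ v ∈ Wsp m Ω s p, Integrable v (volume.restrict Ω) :=
    fun v hv => hv.1.integrable hp1
  have hcoord : ∀ v ∈ Wsp m Ω s p, ∀ i, Integrable (fun x => v x i) (volume.restrict Ω) :=
    fun v hv i => (EuclideanSpace.proj (𝕜 := ℝ) i).integrable_comp (hinteg v hv)
  -- Integrals of a coordinate over measurable sets determine a function a.e. They are bounded
  -- functionals because `L^p` embeds into `L^1` on a set of finite measure.
  have key : ∀ (i : Fin m × Fin m) (A : Set (Space n)), MeasurableSet A →
      ∫ x in A, w x i ∂(volume.restrict Ω) = ∫ x in A, w' x i ∂(volume.restrict Ω) := by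
    intro i A hA
    let f : Wsp m Ω s p →ₗ[ℝ] ℝ :=
      { toFun := fun v => ∫ x in A, (v : Space n → Mat m) x i ∂(volume.restrict Ω)
        map_add' := fun v v' =>
          integral_add (hcoord v v.2 i).integrableOn (hcoord v' v'.2 i).integrableOn
        map_smul' := fun c v => integral_const_mul c _ }
    have hf : ∃ C : ℝ, ∀ v : Wsp m Ω s p, |f v| ≤ C * wspNorm Ω s p (v : Space n → Mat m) := by
      set c : ℝ≥0∞ := (volume.restrict Ω) Set.univ ^
        (1 / (1 : ℝ≥0∞).toReal - 1 / (ENNReal.ofReal p).toReal) with hc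
      have hctop : c ≠ ⊤ := by
        refine ENNReal.rpow_ne_top_of_nonneg ?_ (measure_ne_top _ _)
        rw [ENNReal.toReal_one, ENNReal.toReal_ofReal hp0.le, div_one, sub_nonneg,
          div_le_one hp0]
        exact hp.le
      refine ⟨c.toReal, fun v => ?_⟩
      have h1 : |f v| ≤ ∫ x, ‖(v : Space n → Mat m) x‖ ∂(volume.restrict Ω) := by
        calc |f v| ≤ ∫ x in A, ‖(v : Space n → Mat m) x i‖ ∂(volume.restrict Ω) :=
              norm_integral_le_integral_norm (fun x => (v : Space n → Mat m) x i)
          _ ≤ ∫ x, ‖(v : Space n → Mat m) x i‖ ∂(volume.restrict Ω) :=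
              setIntegral_le_integral (hcoord v v.2 i).norm
                (Eventually.of_forall fun x => norm_nonneg _)
          _ ≤ _ := integral_mono (hcoord v v.2 i).norm (hinteg v v.2).norm
              fun x => PiLp.norm_apply_le _ i
      have h2 : ∫ x, ‖(v : Space n → Mat m) x‖ ∂(volume.restrict Ω) =
          (eLpNorm (v : Space n → Mat m) 1 (volume.restrict Ω)).toReal := by
        rw [integral_norm_eq_lintegral_enorm v.2.1.1, eLpNorm_one_eq_lintegral_enorm]
      have h3 := eLpNorm_le_eLpNorm_mul_rpow_measure_univ hp1 v.2.1.1
      have h4 : (eLpNorm (v : Space n → Mat m) 1 (volume.restrict Ω)).toReal ≤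
          (eLpNorm (v : Space n → Mat m) (ENNReal.ofReal p) (volume.restrict Ω)).toReal *
            c.toReal := by
        rw [← ENNReal.toReal_mul]
        exact ENNReal.toReal_mono (ENNReal.mul_ne_top v.2.1.2.ne hctop) h3
      have h5 : (eLpNorm (v : Space n → Mat m) (ENNReal.ofReal p) (volume.restrict Ω)).toReal ≤
          wspNorm Ω s p (v : Space n → Mat m) := by
        rw [wspNorm, one_div, Real.le_rpow_inv_iff_of_pos ENNReal.toReal_nonneg (by positivity) hp0]
        exact le_add_of_nonneg_right (by positivity)
      calc |f v| ≤ _ := h1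
        _ = _ := h2
        _ ≤ _ := h4
        _ ≤ wspNorm Ω s p (v : Space n → Mat m) * c.toReal := by gcongr
        _ = _ := mul_comm _ _
    exact tendsto_nhds_unique (hlim f hf) (hlim' f hf)
  have hall : ∀ i, (fun x => w x i) =ᵐ[volume.restrict Ω] fun x => w' x i := fun i =>
    (hcoord w hw i).ae_eq_of_forall_setIntegral_eq _ _ (hcoord w' hw' i)
      fun A hA _ => key i A hA
  filter_upwards [ae_all_iff.2 hall] with x hx
  ext i
  exact hx i

end Wsp

/-! ### Compactness in `L^p` by averages over small balls -/

section Compactness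

/-- Jensen's inequality for the oscillation about the mean. -/
theorem lpPow_sub_average_le {X : Type*} [MeasurableSpace X] {V : Type*} [NormedAddCommGroup V]
    [NormedSpace ℝ V] [CompleteSpace V] {p : ℝ} (hp : 1 ≤ p) (ν : Measure X) [IsFiniteMeasure ν]
    [NeZero ν] {u : X → V} (hu : Integrable u ν) :
    lpPow p ν (u - fun _ => ⨍ y, u y ∂ν) ≤
      (ν Set.univ)⁻¹ * ∫⁻ q, ‖u q.1 - u q.2‖ₑ ^ p ∂(ν.prod ν) := by
  have hp0 : 0 < p := by linarith
  set ν' := (ν Set.univ)⁻¹ • ν with hν'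
  have hprob : IsProbabilityMeasure ν' := ⟨by
    rw [hν', Measure.smul_apply, smul_eq_mul]
    exact ENNReal.inv_mul_cancel (by simpa using NeZero.ne ν) (measure_ne_top _ _)⟩
  have hu' : Integrable u ν' := hu.smul_measure (by simpa using NeZero.ne ν)
  have hx : ∀ x, ‖u x - ⨍ y, u y ∂ν‖ₑ ^ p ≤
      (ν Set.univ)⁻¹ * ∫⁻ y, ‖u x - u y‖ₑ ^ p ∂ν := by
    intro x
    have h1 : u x - ⨍ y, u y ∂ν = ∫ y, (u x - u y) ∂ν' := by
      rw [integral_sub (integrable_const _) hu', integral_const, probReal_univ, one_smul]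
      rfl
    have h2 : ‖u x - ⨍ y, u y ∂ν‖ₑ ≤
        eLpNorm (fun y => u x - u y) (ENNReal.ofReal p) ν' := by
      rw [h1]
      refine (enorm_integral_le_lintegral_enorm _).trans ?_
      rw [← eLpNorm_one_eq_lintegral_enorm]
      exact eLpNorm_le_eLpNorm_of_exponent_le (by simpa using hp)
        (aestronglyMeasurable_const.sub hu'.1)
    calc ‖u x - ⨍ y, u y ∂ν‖ₑ ^ p
        ≤ eLpNorm (fun y => u x - u y) (ENNReal.ofReal p) ν' ^ p := by gcongr
      _ = ∫⁻ y, ‖u x - u y‖ₑ ^ p ∂ν' := by rw [eLpNorm_rpow_eq_lpPow hp0]; rfl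
      _ = _ := by rw [hν', lintegral_smul_measure, smul_eq_mul]
  have hmeas : AEMeasurable (fun q : X × X => ‖u q.1 - u q.2‖ₑ ^ p) (ν.prod ν) :=
    (hu.1.comp_fst.sub hu.1.comp_snd).enorm.pow_const p
  rw [lintegral_prod _ hmeas, ← lintegral_const_mul' _ _ (by
    exact ENNReal.inv_ne_top.2 (by simpa using NeZero.ne ν))]
  exact lintegral_mono hx

variable {n m : ℕ} {Ω : Set (Space n)} {s p : ℝ}

/-- The constant in the estimate of the oscillation on balls of radius at most `R`. -/
noncomputable def oscConst (n : ℕ) (s p R : ℝ) : ℝ≥0∞ :=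
  ENNReal.ofReal (2 ^ ((n : ℝ) + p * s) * R ^ (p * s)) / volume (Metric.ball (0 : Space n) 1)

theorem tendsto_oscConst (n : ℕ) (hs : 0 < s) (hp : 0 < p) :
    Tendsto (fun j : ℕ => oscConst n s p (1 / ((j : ℝ) + 1))) atTop (𝓝 0) := by
  have hps : 0 < p * s := by positivity
  have h1 : Tendsto (fun j : ℕ => (2 : ℝ) ^ ((n : ℝ) + p * s) * (1 / ((j : ℝ) + 1)) ^ (p * s)) atTop
      (𝓝 (2 ^ ((n : ℝ) + p * s) * 0 ^ (p * s))) :=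
    (((Real.continuous_rpow_const hps.le).tendsto _).comp
      tendsto_one_div_add_atTop_nhds_zero_nat).const_mul _
  rw [Real.zero_rpow hps.ne', mul_zero] at h1
  have h2 := ENNReal.Tendsto.div_const (ENNReal.tendsto_ofReal h1)
    (b := volume (Metric.ball (0 : Space n) 1)) (Or.inr (Metric.measure_ball_pos _ _ one_pos).ne')
  simpa [oscConst] using h2

theorem enorm_sub_rpow_le (hp : 0 < p) (hs : 0 < s) (u : Space n → Mat m) {x y : Space n} {δ : ℝ}
    (h : ‖x - y‖ ≤ δ) :
    ‖u x - u y‖ₑ ^ p ≤ ENNReal.ofReal (δ ^ ((n : ℝ) + p * s)) * ‖diffVec s p u (x, y)‖ₑ ^ p := by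
  have hδ : 0 ≤ δ := (norm_nonneg _).trans h
  have hexp : 0 < (n : ℝ) / p + s := by positivity
  have h1 : ‖u x - u y‖ ≤ δ ^ ((n : ℝ) / p + s) * ‖diffVec s p u (x, y)‖ := by
    rw [norm_diffVec, diffQuot]
    simp only
    -- On the diagonal the quotient is division by zero, with value zero, but the increment vanishes
    -- there as well.
    by_cases hxy : ‖x - y‖ = 0
    · rw [sub_eq_zero.1 (norm_eq_zero.1 hxy)]
      simp
    · have h0 : 0 < ‖x - y‖ := lt_of_le_of_ne (norm_nonneg _) (Ne.symm hxy)
      have h0' : 0 < ‖x - y‖ ^ ((n : ℝ) / p + s) := by positivity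
      calc ‖u x - u y‖ = ‖x - y‖ ^ ((n : ℝ) / p + s) *
            (‖u x - u y‖ / ‖x - y‖ ^ ((n : ℝ) / p + s)) := by field_simp
        _ ≤ _ := by gcongr
  have h2 : ‖u x - u y‖ₑ ≤ ENNReal.ofReal (δ ^ ((n : ℝ) / p + s)) * ‖diffVec s p u (x, y)‖ₑ := by
    rw [← ofReal_norm, ← ofReal_norm (diffVec s p u (x, y)), ← ENNReal.ofReal_mul (by positivity)]
    exact ENNReal.ofReal_le_ofReal h1
  calc ‖u x - u y‖ₑ ^ p ≤
        (ENNReal.ofReal (δ ^ ((n : ℝ) / p + s)) * ‖diffVec s p u (x, y)‖ₑ) ^ p := by gcongr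
    _ = _ := by
      rw [ENNReal.mul_rpow_of_nonneg _ _ hp.le, ENNReal.ofReal_rpow_of_nonneg (by positivity) hp.le,
        ← Real.rpow_mul hδ]
      congr 4
      field_simp

/-- A fractional Poincaré inequality. Points of the ball are at distance at most `2 * r`, so
Jensen's inequality costs `(2 * r) ^ (n + p * s)`; division by the volume, a multiple of `r ^ n`,
leaves `r ^ (p * s)`, which is small for small balls. -/
theorem lpPow_sub_average_closedBall_le (hp : 1 ≤ p) (hs : 0 < s) {u : Space n → Mat m}
    {x : Space n} {r R : ℝ} (hr : 0 < r) (hrR : r ≤ R)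
    (hu : IntegrableOn u (Metric.closedBall x r)) :
    lpPow p (volume.restrict (Metric.closedBall x r))
      (u - fun _ => ⨍ y in Metric.closedBall x r, u y) ≤
      oscConst n s p R * lpPow p (volSq (Metric.closedBall x r)) (diffVec s p u) := by
  have hp0 : 0 < p := by linarith
  set B := Metric.closedBall x r with hB
  have hBpos : volume B ≠ 0 := (Metric.measure_closedBall_pos _ _ hr).ne'
  have : NeZero (volume.restrict B) := ⟨by simpa [Measure.restrict_eq_zero] using hBpos⟩
  have hBfin : volume B ≠ ⊤ := measure_closedBall_lt_top.ne
  have : IsFiniteMeasure (volume.restrict B) := ⟨by simpa using hBfin.lt_top⟩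
  refine (lpPow_sub_average_le hp _ hu).trans ?_
  have h1 : ∫⁻ q, ‖u q.1 - u q.2‖ₑ ^ p ∂(volSq B) ≤
      ENNReal.ofReal ((2 * r) ^ ((n : ℝ) + p * s)) * lpPow p (volSq B) (diffVec s p u) := by
    rw [lpPow, ← lintegral_const_mul' _ _ ENNReal.ofReal_ne_top]
    refine lintegral_mono_ae ?_
    filter_upwards [ae_volSq_of_ae (ae_restrict_mem Metric.isClosed_closedBall.measurableSet)]
      with q hq
    refine enorm_sub_rpow_le hp0 hs u ?_
    rw [← dist_eq_norm]
    have h1 := Metric.mem_closedBall.1 hq.1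
    have h2 := Metric.mem_closedBall'.1 hq.2
    linarith [dist_triangle q.1 x q.2]
  refine (mul_le_mul_right h1 _).trans ?_
  rw [← mul_assoc]
  gcongr
  rw [Measure.restrict_apply_univ, hB, Measure.addHaar_closedBall volume x hr.le, oscConst,
    finrank_euclideanSpace_fin]
  have hω : volume (Metric.ball (0 : Space n) 1) ≠ 0 := (Metric.measure_ball_pos _ _ one_pos).ne'
  have hω' : volume (Metric.ball (0 : Space n) 1) ≠ ⊤ := measure_ball_lt_top.ne
  rw [ENNReal.mul_inv (Or.inr hω') (Or.inr hω), mul_right_comm, ← div_eq_mul_inv]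
  gcongr
  rw [← ENNReal.ofReal_inv_of_pos (by positivity), ← ENNReal.ofReal_mul (by positivity)]
  refine ENNReal.ofReal_le_ofReal ?_
  rw [Real.mul_rpow (by norm_num) hr.le, Real.rpow_add hr, Real.rpow_natCast]
  have : (r ^ n)⁻¹ * (2 ^ ((n : ℝ) + p * s) * (r ^ n * r ^ (p * s))) =
      2 ^ ((n : ℝ) + p * s) * r ^ (p * s) := by field_simp
  rw [this]
  gcongr

theorem lpPow_iUnion {ι X V : Type*} [Countable ι] [MeasurableSpace X] [NormedAddCommGroup V]
    {μ : Measure X} {A : ι → Set X} (hA : ∀ i, MeasurableSet (A i))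
    (hd : Pairwise (Function.onFun Disjoint A)) (f : X → V) :
    lpPow p (μ.restrict (⋃ i, A i)) f = ∑' i, lpPow p (μ.restrict (A i)) f :=
  lintegral_iUnion hA hd _

/-- The squares `A i ×ˢ A i` are disjoint subsets of `Ω ×ˢ Ω`; only interactions between different
pieces are dropped. -/
theorem tsum_lpPow_volSq_le {ι : Type*} [Countable ι] {A : ι → Set (Space n)}
    (hA : ∀ i, MeasurableSet (A i)) (hd : Pairwise (Function.onFun Disjoint A)) (hAΩ : ∀ i, A i ⊆ Ω)
    (f : Space n × Space n → Mat m) :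
    ∑' i, lpPow p (volSq (A i)) f ≤ lpPow p (volSq Ω) f := by
  have h1 : ∀ i, volSq (A i) = (volume.prod volume).restrict (A i ×ˢ A i) := fun i =>
    Measure.prod_restrict _ _
  simp only [h1]
  rw [← lpPow_iUnion (fun i => (hA i).prod (hA i)) (fun i j hij =>
    Set.disjoint_prod.2 (Or.inl (hd hij)))]
  refine lpPow_mono_measure ?_ f
  rw [volSq, Measure.prod_restrict]
  exact Measure.restrict_mono (Set.iUnion_subset fun i => Set.prod_mono (hAΩ i) (hAΩ i)) le_rfl

/-- Dominated convergence for the counting measure; the `a i` will be the volumes of disjoint balls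
in `Ω`. -/
theorem tendsto_tsum_measure_mul_zero {ι : Type*} [Countable ι] {a : ι → ℝ≥0∞}
    (ha : ∑' i, a i ≠ ⊤) {b : ℕ → ι → ℝ≥0∞} {M : ℝ≥0∞} (hM : M ≠ ⊤) (hb : ∀ k i, b k i ≤ M)
    (hlim : ∀ i, Tendsto (fun k => b k i) atTop (𝓝 0)) :
    Tendsto (fun k => ∑' i, b k i * a i) atTop (𝓝 0) := by
  let _ : MeasurableSpace ι := ⊤
  have h := tendsto_lintegral_of_dominated_convergence (μ := Measure.count)
    (F := fun k i => b k i * a i) (f := fun _ => 0) (fun i => M * a i)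
    (fun k => measurable_from_top) (fun k => Eventually.of_forall fun i => by
      simp only; gcongr; exact hb k i)
    (by rw [lintegral_count, ENNReal.tsum_mul_left]; finiteness)
    (Eventually.of_forall fun i => by
      simpa using ENNReal.Tendsto.mul_const (hlim i)
        (Or.inr (ne_top_of_le_ne_top ha (ENNReal.le_tsum i))))
  simpa [lintegral_count] using h

/-- Bounded sequences in `W^{s,p}` which are uniformly bounded have subsequences that converge
in `L^p`. -/
theorem exists_subseq_cauchy (hp : 1 < p) (hs : 0 < s) (hΩo : IsOpen Ω) (hΩ : volume Ω ≠ ⊤)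
    {u : ℕ → Space n → Mat m} (hu : ∀ k, AEStronglyMeasurable (u k) (volume.restrict Ω))
    {M : ℝ} (hM : ∀ k, ∀ᵐ x ∂(volume.restrict Ω), ‖u k x‖ ≤ M)
    {B : ℝ≥0∞} (hBtop : B ≠ ⊤) (hB : ∀ k, lpPow p (volSq Ω) (diffVec s p (u k)) ≤ B) :
    ∃ φ : ℕ → ℕ, StrictMono φ ∧ ∀ ε : ℝ≥0∞, 0 < ε → ∃ N, ∀ k ≥ N, ∀ l ≥ N,
      lpPow p (volume.restrict Ω) (u (φ k) - u (φ l)) ≤ ε := by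
  have hp0 : 0 < p := by linarith
  have hfin : IsFiniteMeasure (volume.restrict Ω) := ⟨by simpa using hΩ.lt_top⟩
  have hinteg : ∀ k, IntegrableOn (u k) Ω := fun k =>
    Integrable.of_bound (hu k) M (hM k)
  -- At each scale `1 / (j + 1)`, the Besicovitch covering theorem fills `Ω` up to a null set with
  -- countably many disjoint closed balls inside `Ω`.
  have hcover : ∀ j : ℕ, ∃ (t : Set (Space n)) (r : Space n → ℝ), t.Countable ∧
      (∀ x ∈ t, 0 < r x ∧ r x < 1 / ((j : ℝ) + 1) ∧ Metric.closedBall x (r x) ⊆ Ω) ∧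
      volume (Ω \ ⋃ x ∈ t, Metric.closedBall x (r x)) = 0 ∧
      t.PairwiseDisjoint fun x => Metric.closedBall x (r x) := by
    intro j
    obtain ⟨t, r, h1, h2, h3, h4, h5⟩ := Besicovitch.exists_disjoint_closedBall_covering_ae
      (volume : Measure (Space n)) (fun x => {r | Metric.closedBall x r ⊆ Ω}) Ω (by
        intro x hx δ hδ
        obtain ⟨ε, hε, hball⟩ := Metric.nhds_basis_closedBall.mem_iff.1 (hΩo.mem_nhds hx)
        refine ⟨min ε (δ / 2), ?_, lt_min hε (by positivity), ?_⟩
        · exact (Metric.closedBall_subset_closedBall (min_le_left _ _)).trans hball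
        · exact (min_le_right _ _).trans_lt (by linarith))
      (fun _ => 1 / ((j : ℝ) + 1)) (fun x _ => by positivity)
    exact ⟨t, r, h1, fun x hx => ⟨(h3 x hx).2.1, (h3 x hx).2.2, (h3 x hx).1⟩, h4, h5⟩
  choose t r htc hr hcov hdisj using hcover
  have : ∀ j, Countable (t j) := fun j => (htc j).to_subtype
  let A : (j : ℕ) → t j → Set (Space n) := fun j x => Metric.closedBall (x : Space n) (r j x)
  have hAm : ∀ j i, MeasurableSet (A j i) := fun j i => Metric.isClosed_closedBall.measurableSet
  have hAΩ : ∀ j i, A j i ⊆ Ω := fun j i => (hr j i i.2).2.2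
  have hAd : ∀ j, Pairwise (Function.onFun Disjoint (A j)) := fun j x y hxy =>
    hdisj j x.2 y.2 (fun h => hxy (Subtype.ext h))
  have hAae : ∀ j, volume.restrict Ω = volume.restrict (⋃ i, A j i) := by
    intro j
    refine Measure.restrict_congr_set ?_
    have h1 : (⋃ i, A j i) = ⋃ x ∈ t j, Metric.closedBall x (r j x) :=
      (Set.biUnion_eq_iUnion (t j) fun x _ => Metric.closedBall x (r j x)).symm
    refine (ae_eq_set.2 ⟨h1 ▸ hcov j, ?_⟩)
    rw [Set.sdiff_eq_empty.2 (Set.iUnion_subset (hAΩ j))]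
    exact measure_empty
  -- The averages over the balls of all scales form one point of a countable product of compact
  -- balls, so a single subsequence converges at every scale.
  let a : ℕ → (Σ j, t j) → Mat m := fun k i => ⨍ y in A i.1 i.2, u k y
  have ha : ∀ k, a k ∈ Set.pi Set.univ fun _ : Σ j, t j => Metric.closedBall (0 : Mat m) M := by
    intro k i _
    have hpos : volume (A i.1 i.2) ≠ 0 :=
      (Metric.measure_closedBall_pos _ _ (hr i.1 i.2 i.2.2).1).ne'
    have h1 : ∀ᵐ y ∂(volume.restrict (A i.1 i.2)), u k y ∈ Metric.closedBall (0 : Mat m) M := by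
      filter_upwards [ae_mono (Measure.restrict_mono (hAΩ i.1 i.2) le_rfl) (hM k)] with y hy
      simpa using hy
    exact (convex_closedBall (0 : Mat m) M).set_average_mem Metric.isClosed_closedBall hpos
      measure_closedBall_lt_top.ne h1 ((hinteg k).mono_set (hAΩ i.1 i.2))
  obtain ⟨c, hc, φ, hφ, hlim⟩ :=
    (isCompact_univ_pi fun _ : Σ j, t j => isCompact_closedBall (0 : Mat m) M).tendsto_subseq ha
  rw [tendsto_pi_nhds] at hlim
  refine ⟨φ, hφ, fun ε hε => ?_⟩
  have h2top : (2 : ℝ≥0∞) ^ (p - 1) ≠ ⊤ := ENNReal.rpow_ne_top_of_nonneg (by linarith) (by simp)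
  -- `T j k` measures the distance to the step function with the limiting averages `c` at scale `j`.
  -- It splits into the oscillation about the actual averages and the error `ρ j k` of these
  -- averages.
  let T : ℕ → ℕ → ℝ≥0∞ := fun j k =>
    ∑' i, lpPow p (volume.restrict (A j i)) (u (φ k) - fun _ => c ⟨j, i⟩)
  let ρ : ℕ → ℕ → ℝ≥0∞ := fun j k =>
    ∑' i, ‖a (φ k) ⟨j, i⟩ - c ⟨j, i⟩‖ₑ ^ p * volume (A j i)
  have hmeasA : ∀ j i k, AEStronglyMeasurable (u k) (volume.restrict (A j i)) := fun j i k =>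
    (hu k).mono_measure (Measure.restrict_mono (hAΩ j i) le_rfl)
  have hosc : ∀ j k, ∑' i, lpPow p (volume.restrict (A j i)) (u k - fun _ => a k ⟨j, i⟩) ≤
      oscConst n s p (1 / ((j : ℝ) + 1)) * B := by
    intro j k
    calc _ ≤ ∑' i, oscConst n s p (1 / ((j : ℝ) + 1)) *
          lpPow p (volSq (A j i)) (diffVec s p (u k)) := by
          refine ENNReal.tsum_le_tsum fun i => ?_
          exact lpPow_sub_average_closedBall_le hp.le hs (hr j i i.2).1 (hr j i i.2).2.1.le
            ((hinteg k).mono_set (hAΩ j i))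
      _ = oscConst n s p (1 / ((j : ℝ) + 1)) *
          ∑' i, lpPow p (volSq (A j i)) (diffVec s p (u k)) := ENNReal.tsum_mul_left
      _ ≤ _ := by
          gcongr
          exact (tsum_lpPow_volSq_le (hAm j) (hAd j) (hAΩ j) _).trans (hB k)
  have hT : ∀ j k, T j k ≤ 2 ^ (p - 1) * (oscConst n s p (1 / ((j : ℝ) + 1)) * B + ρ j k) := by
    intro j k
    calc T j k ≤ ∑' i, 2 ^ (p - 1) *
          (lpPow p (volume.restrict (A j i)) (u (φ k) - fun _ => a (φ k) ⟨j, i⟩) +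
            ‖a (φ k) ⟨j, i⟩ - c ⟨j, i⟩‖ₑ ^ p * volume (A j i)) := by
          refine ENNReal.tsum_le_tsum fun i => ?_
          have h1 : u (φ k) - (fun _ => c ⟨j, i⟩) = (u (φ k) - fun _ => a (φ k) ⟨j, i⟩) +
              fun _ => a (φ k) ⟨j, i⟩ - c ⟨j, i⟩ := by
            funext x; simp
          rw [h1]
          refine (lpPow_add_le hp.le ((hmeasA j i (φ k)).sub aestronglyMeasurable_const)).trans ?_
          gcongr
          rw [lpPow, lintegral_const, Measure.restrict_apply_univ]
      _ = 2 ^ (p - 1) *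
          (∑' i, lpPow p (volume.restrict (A j i)) (u (φ k) - fun _ => a (φ k) ⟨j, i⟩) +
            ρ j k) := by
          rw [ENNReal.tsum_mul_left, ENNReal.tsum_add]
      _ ≤ _ := by
          gcongr
          exact hosc j (φ k)
  have hρ : ∀ j, Tendsto (ρ j) atTop (𝓝 0) := by
    intro j
    refine tendsto_tsum_measure_mul_zero (M := ENNReal.ofReal (M + M) ^ p) ?_ (by finiteness)
      (fun k i => ?_) (fun i => ?_)
    · rw [← measure_iUnion (hAd j) (hAm j)]
      exact ne_top_of_le_ne_top hΩ (measure_mono (Set.iUnion_subset (hAΩ j)))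
    · gcongr
      rw [← ofReal_norm]
      refine ENNReal.ofReal_le_ofReal ((norm_sub_le _ _).trans (add_le_add ?_ ?_))
      · simpa using ha (φ k) ⟨j, i⟩ trivial
      · simpa using hc ⟨j, i⟩ trivial
    · have h1 : Tendsto (fun k => a (φ k) ⟨j, i⟩ - c ⟨j, i⟩) atTop (𝓝 0) :=
        tendsto_sub_nhds_zero_iff.2 (hlim ⟨j, i⟩)
      have h2 := ((ENNReal.continuous_rpow_const (y := p)).tendsto _).comp h1.enorm
      simpa [Function.comp_def, hp0] using h2
  have hpair : ∀ j k l, lpPow p (volume.restrict Ω) (u (φ k) - u (φ l)) ≤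
      2 ^ (p - 1) * (T j k + T j l) := by
    intro j k l
    rw [hAae j, lpPow_iUnion (hAm j) (hAd j), ← ENNReal.tsum_add, ← ENNReal.tsum_mul_left]
    refine ENNReal.tsum_le_tsum fun i => ?_
    have h1 : u (φ k) - u (φ l) =
        (u (φ k) - fun _ => c ⟨j, i⟩) + ((fun _ => c ⟨j, i⟩) - u (φ l)) := by
      funext x; simp
    have h2 : lpPow p (volume.restrict (A j i)) ((fun _ => c ⟨j, i⟩) - u (φ l)) =
        lpPow p (volume.restrict (A j i)) (u (φ l) - fun _ => c ⟨j, i⟩) :=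
      lintegral_congr fun x => by
        rw [Pi.sub_apply, Pi.sub_apply, enorm_sub_rev]
    rw [h1, ← h2]
    exact lpPow_add_le hp.le ((hmeasA j i (φ k)).sub aestronglyMeasurable_const)
  -- The constants of the two quasi-triangle inequalities `hpair` and `hT` combined.
  let Z : ℝ≥0∞ → ℝ≥0∞ := fun x => 2 ^ (p - 1) * (2 ^ (p - 1) * x + 2 ^ (p - 1) * x)
  have hZ : Tendsto Z (𝓝 0) (𝓝 0) := by
    have h1 : Tendsto (fun x : ℝ≥0∞ => 2 ^ (p - 1) * x) (𝓝 0) (𝓝 0) := by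
      simpa using ENNReal.Tendsto.const_mul (tendsto_id (x := 𝓝 (0 : ℝ≥0∞))) (Or.inr h2top)
    simpa using ENNReal.Tendsto.const_mul (h1.add h1) (Or.inr h2top)
  obtain ⟨δ, hδ, hδε⟩ := ENNReal.nhds_zero_basis_Iic.eventually_iff.1
    ((ENNReal.tendsto_nhds_zero.1 hZ) ε hε)
  have hδ2 : 0 < δ / 2 := ENNReal.half_pos hδ.ne'
  have hosc0 : Tendsto (fun j : ℕ => oscConst n s p (1 / ((j : ℝ) + 1)) * B) atTop (𝓝 0) := by
    simpa using ENNReal.Tendsto.mul_const (tendsto_oscConst n hs hp0) (Or.inr hBtop)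
  -- The scale is fixed first, as the oscillation is small uniformly in `k`; only then is `N` chosen
  -- for the averages at that scale.
  obtain ⟨j, hj⟩ := ((ENNReal.tendsto_nhds_zero.1 hosc0) _ hδ2).exists
  obtain ⟨N, hN⟩ := eventually_atTop.1 ((ENNReal.tendsto_nhds_zero.1 (hρ j)) _ hδ2)
  have hTk : ∀ k ≥ N, T j k ≤ 2 ^ (p - 1) * δ := fun k hk => by
    refine (hT j k).trans ?_
    rw [← ENNReal.add_halves δ]
    gcongr
    exact hN k hk
  refine ⟨N, fun k hk l hl => (hpair j k l).trans ?_⟩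
  calc _ ≤ Z δ := by
        simp only [Z]
        gcongr
        · exact hTk k hk
        · exact hTk l hl
    _ ≤ ε := hδε (Set.mem_Iic.2 le_rfl)

theorem exists_tendsto_of_lpPow_cauchy {X V : Type*} [MeasurableSpace X] {μ : Measure X}
    [NormedAddCommGroup V] [CompleteSpace V] (hp : 1 < p) {u : ℕ → X → V}
    (hu : ∀ k, MemLp (u k) (ENNReal.ofReal p) μ)
    (hcau : ∀ ε : ℝ≥0∞, 0 < ε → ∃ N, ∀ k ≥ N, ∀ l ≥ N, lpPow p μ (u k - u l) ≤ ε) :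
    ∃ w, MemLp w (ENNReal.ofReal p) μ ∧ Tendsto (fun k => lpPow p μ (u k - w)) atTop (𝓝 0) := by
  have hp0 : 0 < p := by linarith
  have : Fact (1 ≤ ENNReal.ofReal p) := ⟨by simpa using hp.le⟩
  have hc : CauchySeq fun k => (hu k).toLp (u k) := by
    rw [EMetric.cauchySeq_iff]
    intro ε hε
    obtain ⟨δ, hδ0, hδ⟩ := exists_between hε
    obtain ⟨N, hN⟩ := hcau (δ ^ p) (ENNReal.rpow_pos_of_nonneg hδ0 hp0.le)
    refine ⟨N, fun k hk l hl => ?_⟩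
    rw [Lp.edist_toLp_toLp]
    refine lt_of_le_of_lt ?_ hδ
    have := hN k hk l hl
    rwa [← eLpNorm_rpow_eq_lpPow hp0, ENNReal.rpow_le_rpow_iff hp0] at this
  obtain ⟨w, hw⟩ := cauchySeq_tendsto_of_complete hc
  refine ⟨w, Lp.memLp w, ?_⟩
  rw [tendsto_lpPow_zero_iff hp0]
  exact (Lp.tendsto_Lp_iff_tendsto_eLpNorm' _ _).1 hw |>.congr fun k =>
    eLpNorm_congr_ae ((hu k).coeFn_toLp.sub EventuallyEq.rfl)

end Compactness

/-- The convergence of the `p`-th powers of `L^p` norms under `L^p` convergence. -/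
theorem tendsto_lpPow_of_tendsto_sub {X V : Type*} [MeasurableSpace X] {μ : Measure X}
    [NormedAddCommGroup V] {p : ℝ} (hp : 1 ≤ p) {f : ℕ → X → V} {g : X → V}
    (hf : ∀ k, AEStronglyMeasurable (f k) μ) (hg : AEStronglyMeasurable g μ)
    (hgtop : lpPow p μ g ≠ ⊤) (h : Tendsto (fun k => lpPow p μ (f k - g)) atTop (𝓝 0)) :
    Tendsto (fun k => lpPow p μ (f k)) atTop (𝓝 (lpPow p μ g)) := by
  have hp0 : 0 < p := by linarith
  have hp1 : 1 ≤ ENNReal.ofReal p := by simpa using hp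
  rw [tendsto_lpPow_zero_iff hp0] at h
  have hg' : eLpNorm g (ENNReal.ofReal p) μ ≠ ⊤ := ((lpPow_lt_top_iff hp0 g).1 hgtop.lt_top).ne
  have key : Tendsto (fun k => eLpNorm (f k) (ENNReal.ofReal p) μ) atTop
      (𝓝 (eLpNorm g (ENNReal.ofReal p) μ)) := by
    have h1 := ENNReal.Tendsto.sub (tendsto_const_nhds (x := eLpNorm g (ENNReal.ofReal p) μ)) h
      (Or.inl hg')
    have h2 := (tendsto_const_nhds (x := eLpNorm g (ENNReal.ofReal p) μ)).add h
    rw [tsub_zero] at h1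
    rw [add_zero] at h2
    refine tendsto_of_tendsto_of_tendsto_of_le_of_le h1 h2 (fun k => ?_) (fun k => ?_)
    · refine tsub_le_iff_right.2 ?_
      have h3 := eLpNorm_sub_le (hf k) ((hf k).sub hg) hp1
      rwa [sub_sub_cancel] at h3
    · have h3 := eLpNorm_add_le hg ((hf k).sub hg) hp1
      rwa [add_sub_cancel] at h3
  simp only [← eLpNorm_rpow_eq_lpPow hp0]
  exact ((ENNReal.continuous_rpow_const (y := p)).tendsto _).comp key

/-! ### Locally constant functions on connected sets -/

section Connected

variable {n : ℕ} {Ω : Set (Space n)} {V : Type*}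

theorem ae_restrict_of_forall_ball {Q : Space n → Prop}
    (h : ∀ x ∈ Ω, ∃ r : ℝ, 0 < r ∧ ∀ᵐ y ∂(volume.restrict (Metric.ball x r)), Q y) :
    volume {x ∈ Ω | ¬ Q x} = 0 := by
  refine measure_null_of_locally_null _ fun x hx => ?_
  obtain ⟨r, hr, hQ⟩ := h x hx.1
  rw [ae_restrict_iff' measurableSet_ball] at hQ
  refine ⟨Metric.ball x r ∩ {x ∈ Ω | ¬ Q x},
    inter_mem (mem_nhdsWithin_of_mem_nhds (Metric.ball_mem_nhds x hr)) self_mem_nhdsWithin,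
    measure_mono_null ?_ hQ⟩
  rintro y ⟨hy1, -, hy2⟩ hy3
  exact hy2 (hy3 hy1)

/-- A function whose increments over short distances vanish is constant on a connected set;
if it vanishes on a set of positive measure then it vanishes. -/
theorem ae_eq_zero_of_locally_const [Zero V] {h : Space n → V} {η : ℝ} (hη : 0 < η)
    (hΩo : IsOpen Ω) (hΩc : IsPreconnected Ω)
    (hloc : ∀ᵐ q ∂(volSq Ω), ‖q.1 - q.2‖ ≤ η → h q.1 = h q.2)
    {A : Set (Space n)} (hA : A ⊆ Ω) (hAm : NullMeasurableSet A volume) (hA0 : volume A ≠ 0)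
    (hhA : ∀ᵐ x ∂(volume.restrict A), h x = 0) :
    ∀ᵐ x ∂(volume.restrict Ω), h x = 0 := by
  have hballpos : ∀ (x : Space n) (r : ℝ), 0 < r → volume (Metric.ball x r) ≠ 0 := fun x r hr =>
    (Metric.measure_ball_pos _ _ hr).ne'
  have hconst : ∀ x ∈ Ω, ∃ r : ℝ, 0 < r ∧ ∃ c, ∀ᵐ y ∂(volume.restrict (Metric.ball x r)),
      h y = c := by
    intro x hx
    obtain ⟨r0, hr0, hball⟩ := Metric.isOpen_iff.1 hΩo x hx
    set r := min r0 (η / 2) with hr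
    have hrpos : 0 < r := lt_min hr0 (by positivity)
    have hsub : Metric.ball x r ⊆ Ω := (Metric.ball_subset_ball (min_le_left _ _)).trans hball
    have h1 : ∀ᵐ q ∂(volSq (Metric.ball x r)), h q.1 = h q.2 := by
      have hle : volSq (Metric.ball x r) ≤ volSq Ω := by
        rw [volSq, volSq, Measure.prod_restrict, Measure.prod_restrict]
        exact Measure.restrict_mono (Set.prod_mono hsub hsub) le_rfl
      filter_upwards [ae_mono hle hloc, ae_volSq_of_ae (ae_restrict_mem measurableSet_ball)]
        with q hq1 hq2
      refine hq1 ?_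
      rw [← dist_eq_norm]
      have h1 := Metric.mem_ball.1 hq2.1
      have h2 := Metric.mem_ball'.1 hq2.2
      linarith [dist_triangle q.1 x q.2, min_le_right r0 (η / 2)]
    -- By Fubini, for almost every `x'` in the ball the value `h x'` is the value of `h` at almost
    -- every other point.
    have h2 := Measure.ae_ae_of_ae_prod h1
    have hne : NeZero (volume.restrict (Metric.ball x r)) :=
      ⟨by simpa [Measure.restrict_eq_zero] using hballpos x r hrpos⟩
    obtain ⟨x', hx'⟩ := h2.exists
    exact ⟨r, hrpos, h x', hx'.mono fun y hy => hy.symm⟩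
  -- The points near which `h` is a.e. zero, and those near which it is a.e. a nonzero constant,
  -- form two open sets that cover `Ω` and do not meet in it.
  let O : Set (Space n) := {x | ∃ r : ℝ, 0 < r ∧
    ∀ᵐ y ∂(volume.restrict (Metric.ball x r)), h y = 0}
  let O' : Set (Space n) := {x | ∃ r : ℝ, 0 < r ∧ ∃ c, c ≠ 0 ∧
    ∀ᵐ y ∂(volume.restrict (Metric.ball x r)), h y = c}
  have hsubball : ∀ {x y : Space n} {r : ℝ}, y ∈ Metric.ball x r →
      ∃ r' : ℝ, 0 < r' ∧ Metric.ball y r' ⊆ Metric.ball x r := fun hy =>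
    Metric.isOpen_iff.1 Metric.isOpen_ball _ hy
  have hOo : IsOpen O := by
    rw [Metric.isOpen_iff]
    rintro x ⟨r, hr, hx⟩
    refine ⟨r, hr, fun y hy => ?_⟩
    obtain ⟨r', hr', hsub⟩ := hsubball hy
    exact ⟨r', hr', ae_mono (Measure.restrict_mono hsub le_rfl) hx⟩
  have hO'o : IsOpen O' := by
    rw [Metric.isOpen_iff]
    rintro x ⟨r, hr, c, hc, hx⟩
    refine ⟨r, hr, fun y hy => ?_⟩
    obtain ⟨r', hr', hsub⟩ := hsubball hy
    exact ⟨r', hr', c, hc, ae_mono (Measure.restrict_mono hsub le_rfl) hx⟩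
  have hcov : Ω ⊆ O ∪ O' := by
    intro x hx
    obtain ⟨r, hr, c, hc⟩ := hconst x hx
    by_cases h0 : c = 0
    · exact Or.inl ⟨r, hr, h0 ▸ hc⟩
    · exact Or.inr ⟨r, hr, c, h0, hc⟩
  have hdisj : Ω ∩ (O ∩ O') = ∅ := by
    refine Set.eq_empty_iff_forall_notMem.2 ?_
    rintro x ⟨-, ⟨r, hr, hx⟩, r', hr', c, hc, hx'⟩
    have hne : NeZero (volume.restrict (Metric.ball x (min r r'))) :=
      ⟨by simpa [Measure.restrict_eq_zero] using hballpos x _ (lt_min hr hr')⟩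
    have h1 : ∀ᵐ y ∂(volume.restrict (Metric.ball x (min r r'))), h y = 0 :=
      ae_mono (Measure.restrict_mono (Metric.ball_subset_ball (min_le_left r r')) le_rfl) hx
    have h2 : ∀ᵐ y ∂(volume.restrict (Metric.ball x (min r r'))), h y = c :=
      ae_mono (Measure.restrict_mono (Metric.ball_subset_ball (min_le_right r r')) le_rfl) hx'
    obtain ⟨y, hy1, hy2⟩ := (h1.and h2).exists
    exact hc (hy2.symm.trans hy1)
  rcases isPreconnected_iff_subset_of_disjoint.1 hΩc O O' hOo hO'o hcov hdisj with hsub | hsub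
  · have h0 := ae_restrict_of_forall_ball (Ω := Ω) (Q := fun x => h x = 0) fun x hx => hsub hx
    rw [ae_restrict_iff' hΩo.measurableSet]
    refine measure_mono_null ?_ h0
    intro x hx
    simpa using hx
  · exfalso
    have h0 := ae_restrict_of_forall_ball (Ω := Ω) (Q := fun x => h x ≠ 0) fun x hx => by
      obtain ⟨r, hr, c, hc, hx⟩ := hsub hx
      exact ⟨r, hr, hx.mono fun y hy => by rwa [hy]⟩
    rw [ae_restrict_iff'₀ hAm] at hhA
    refine hA0 (measure_mono_null (t := {x ∈ Ω | ¬ h x ≠ 0} ∪ {x | ¬ (x ∈ A → h x = 0)}) ?_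
      (measure_union_null h0 hhA))
    intro x hx
    by_cases hx0 : h x = 0
    · exact Or.inl ⟨hA hx, by simpa using hx0⟩
    · exact Or.inr (by simpa using ⟨hx, hx0⟩)

end Connected

/-! ### Semicontinuity combined with convergent upper bounds -/

section Order

/-- A sequence bounded by a convergent one, along which `a` is lower semicontinuous. -/
theorem le_of_lsc {φ X : ℕ → ℝ≥0∞} {a c : ℝ≥0∞}
    (hlsc : ∀ c, (∃ᶠ k in atTop, φ k ≤ c) → a ≤ c) (hle : ∀ k, φ k ≤ X k)
    (hX : Tendsto X atTop (𝓝 c)) : a ≤ c :=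
  le_of_forall_gt_imp_ge_of_dense fun b hb => hlsc b (Eventually.frequently
    ((hX.eventually_lt_const hb).mono fun k hk => (hle k).trans hk.le))

/-- Semicontinuity bounds the limit inferior from below, the majorant `X` bounds the limit superior
from above. -/
theorem tendsto_of_lsc {φ X : ℕ → ℝ≥0∞} {a : ℝ≥0∞}
    (hlsc : ∀ c, (∃ᶠ k in atTop, φ k ≤ c) → a ≤ c) (hle : ∀ k, φ k ≤ X k)
    (hX : Tendsto X atTop (𝓝 a)) : Tendsto φ atTop (𝓝 a) := by
  refine tendsto_order.2 ⟨fun b hb => ?_, fun b hb => ?_⟩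
  · by_contra hcon
    rw [not_eventually] at hcon
    exact absurd (hlsc b (hcon.mono fun k hk => not_lt.1 hk)) (not_le.2 hb)
  · exact (hX.eventually_lt_const hb).mono fun k hk => (hle k).trans_lt hk

end Order

/-! ### The functional in the chart: coercivity, compactness, semicontinuity -/

/-- The measure `ρ(x - y)^l d(x,y)` on `Ω × Ω`. -/
noncomputable def kerMeas {n : ℕ} (Ω : Set (Space n)) (l : ℕ) (ρ : Space n → ℝ) :
    Measure (Space n × Space n) :=
  (volSq Ω).withDensity fun q => ENNReal.ofReal (ρ (q.1 - q.2) ^ l)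

/-- The data of the variational problem, with the metric expressed in a chart. -/
structure Setting {n m : ℕ} (Ω D : Set (Space n)) (s p : ℝ) (l : ℕ) (ρ : Space n → ℝ)
    (K : Set (Mat m)) (z : ℝ) (L : NNReal) (Λ E : Mat m → Mat m) : Prop where
  chart : IsChart K z L Λ E
  log_eq : ∀ A ∈ K, Λ A = Log A
  one_lt_p : 1 < p
  s_pos : 0 < s
  isOpen : IsOpen Ω
  vol_ne_top : volume Ω ≠ ⊤
  nullMeas : NullMeasurableSet D volume
  moll : IsMollifier ρ
  l_eq : l = 0 ∨ l = 1

namespace Setting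

variable {n m : ℕ} {Ω D : Set (Space n)} {s p : ℝ} {l : ℕ} {ρ : Space n → ℝ}
    {K : Set (Mat m)} {z : ℝ} {L : NNReal} {Λ E : Mat m → Mat m}

theorem p_pos (S : Setting Ω D s p l ρ K z L Λ E) : 0 < p := by linarith [S.one_lt_p]

theorem finite (S : Setting Ω D s p l ρ K z L Λ E) : IsFiniteMeasure (volume.restrict Ω) :=
  ⟨by simpa using S.vol_ne_top.lt_top⟩

theorem measurable_ker (S : Setting Ω D s p l ρ K z L Λ E) :
    Measurable fun q : Space n × Space n => ENNReal.ofReal (ρ (q.1 - q.2) ^ l) := by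
  have : Measurable ρ := S.moll.smooth.continuous.measurable
  fun_prop

theorem exists_ker_le (S : Setting Ω D s p l ρ K z L Λ E) :
    ∃ C : ℝ≥0∞, C ≠ ⊤ ∧ ∀ x, ENNReal.ofReal (ρ x ^ l) ≤ C := by
  obtain ⟨C, hC⟩ := S.moll.compactSupport.exists_bound_of_continuous S.moll.smooth.continuous
  refine ⟨ENNReal.ofReal (max C 1), ENNReal.ofReal_ne_top, fun x => ENNReal.ofReal_le_ofReal ?_⟩
  rcases S.l_eq with h | h
  · simp [h]
  · rw [h, pow_one]
    exact ((le_abs_self _).trans (hC x)).trans (le_max_left _ _)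

/-- The superlevel set of `ρ` is a ball about the origin, which bounds the kernel below near the
diagonal; the minimum with one covers `l = 0`. -/
theorem exists_le_ker (S : Setting Ω D s p l ρ K z L Λ E) :
    ∃ τ : ℝ≥0∞, τ ≠ 0 ∧ τ ≠ ⊤ ∧ ∃ η : ℝ, 0 < η ∧ ∀ x, ‖x‖ ≤ η → τ ≤ ENNReal.ofReal (ρ x ^ l) := by
  obtain ⟨τ, η, hτ, -, hη, hset⟩ := S.moll.superlevel
  refine ⟨ENNReal.ofReal (min τ 1), (ENNReal.ofReal_pos.2 (lt_min hτ one_pos)).ne',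
    ENNReal.ofReal_ne_top, η, hη, fun x hx => ENNReal.ofReal_le_ofReal ?_⟩
  have h1 : τ ≤ ρ x := hset.symm.subset hx
  rcases S.l_eq with h | h
  · simp [h]
  · rw [h, pow_one]
    exact (min_le_left _ _).trans h1

theorem exists_bound (S : Setting Ω D s p l ρ K z L Λ E) : ∃ M : ℝ, ∀ A ∈ K, ‖A‖ ≤ M := by
  refine ⟨‖E 0‖ + L * z, fun A hA => ?_⟩
  have h1 := S.chart.lip'.dist_le_mul (Λ A) 0
  rw [S.chart.left_inv A hA, dist_eq_norm, dist_eq_norm, sub_zero] at h1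
  have h2 := S.chart.norm_le A hA
  calc ‖A‖ = ‖E 0 + (A - E 0)‖ := by rw [add_sub_cancel]
    _ ≤ ‖E 0‖ + ‖A - E 0‖ := norm_add_le _ _
    _ ≤ ‖E 0‖ + L * ‖Λ A‖ := by gcongr
    _ ≤ _ := by gcongr

theorem norm_chart_sub_le (S : Setting Ω D s p l ρ K z L Λ E) (A B : Mat m) :
    ‖Λ A - Λ B‖ ≤ L * ‖A - B‖ := by
  simpa [dist_eq_norm] using S.chart.lip.dist_le_mul A B

theorem aesm_comp (S : Setting Ω D s p l ρ K z L Λ E) {μ : Measure (Space n)}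
    {w : Space n → Mat m} (hw : AEStronglyMeasurable w μ) : AEStronglyMeasurable (Λ ∘ w) μ :=
  S.chart.lip.continuous.comp_aestronglyMeasurable hw

theorem diffVec_comp_le {F : Mat m → Mat m} (hF : LipschitzWith L F) (hp : 0 < p)
    (μ : Measure (Space n × Space n)) (w : Space n → Mat m) :
    lpPow p μ (diffVec s p (F ∘ w)) ≤ (L : ℝ≥0∞) ^ p * lpPow p μ (diffVec s p w) := by
  have := lpPow_lipschitz_comp_le (μ := μ) hp.le (L := L) (f := diffVec s p w) (g := 0)
    (f' := diffVec s p (F ∘ w)) (g' := 0) (Eventually.of_forall fun q => by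
      simp only [Pi.zero_apply, sub_zero, diffVec, norm_smul, Function.comp]
      have := hF.dist_le_mul (w q.1) (w q.2)
      rw [dist_eq_norm, dist_eq_norm] at this
      calc _ ≤ ‖(‖q.1 - q.2‖ ^ ((n : ℝ) / p + s))⁻¹‖ * (L * ‖w q.1 - w q.2‖) := by gcongr
        _ = _ := by ring)
  simpa using this

/-- On `K` the metric is the norm distance of the images under `Λ`, and `(n / p + s) * p = n + p *
s`. As a power of an `L^p` norm, the regularizer is open to Fatou's lemma and to strict convexity.
-/
theorem phi_eq (S : Setting Ω D s p l ρ K z L Λ E) {w : Space n → Mat m}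
    (hw : AEStronglyMeasurable w (volume.restrict Ω))
    (hK : ∀ᵐ x ∂(volume.restrict Ω), w x ∈ K) :
    Phi Ω s p l ρ w = lpPow p (kerMeas Ω l ρ) (diffVec s p (Λ ∘ w)) := by
  have hp0 := S.p_pos
  have hm := aestronglyMeasurable_diffVec (s := s) (p := p) (S.aesm_comp hw)
  rw [lpPow, kerMeas, lintegral_withDensity_eq_lintegral_mul₀ S.measurable_ker.aemeasurable
    (hm.enorm.pow_const p), Phi]
  refine lintegral_congr_ae ?_
  filter_upwards [ae_volSq_of_ae hK] with q hq
  rw [Pi.mul_apply, mul_comm (ENNReal.ofReal _), ENNReal.ofReal_mul (by unfold logDist; positivity)]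
  congr 1
  rw [← ofReal_norm, norm_diffVec, ENNReal.ofReal_rpow_of_nonneg (by unfold diffQuot; positivity)
    hp0.le, diffQuot, Real.div_rpow (norm_nonneg _) (by positivity),
    ← Real.rpow_mul (norm_nonneg _), logDist, Function.comp, Function.comp, S.log_eq _ hq.1,
    S.log_eq _ hq.2]
  congr 3
  field_simp

/-- The fidelity term in the chart. -/
theorem func_eq (S : Setting Ω D s p l ρ K z L Λ E) {v w : Space n → Mat m}
    (hv : ∀ᵐ x ∂(volume.restrict Ω), v x ∈ K) (hw : ∀ᵐ x ∂(volume.restrict Ω), w x ∈ K) (α : ℝ) :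
    Func Ω D s p l ρ α v w = lpPow p (volume.restrict (Ω \ D)) (Λ ∘ w - Λ ∘ v) +
      ENNReal.ofReal α * Phi Ω s p l ρ w := by
  have hp0 := S.p_pos
  have hΩD : NullMeasurableSet (Ω \ D) volume :=
    S.isOpen.measurableSet.nullMeasurableSet.diff S.nullMeas
  rw [Func]
  congr 1
  rw [lintegral_indicator₀ (hΩD.mono_ac Measure.absolutelyContinuous_restrict),
    Measure.restrict_restrict₀ (hΩD.mono_ac Measure.absolutelyContinuous_restrict),
    Set.inter_eq_left.2 Set.sdiff_subset, lpPow]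
  refine lintegral_congr_ae ?_
  have hle := Measure.restrict_mono (Set.sdiff_subset : Ω \ D ⊆ Ω) (le_refl volume)
  filter_upwards [ae_mono hle hv, ae_mono hle hw] with x hx1 hx2
  rw [Pi.sub_apply, ← ofReal_norm, ENNReal.ofReal_rpow_of_nonneg (norm_nonneg _) hp0.le, logDist,
    Function.comp, Function.comp, S.log_eq _ hx1, S.log_eq _ hx2]

/-- Images under `Λ` of points of `K` have norm at most `z`. The bound does not depend on the two
functions and allows the fidelity to be subtracted in `ℝ≥0∞`. -/
theorem exists_data_le (S : Setting Ω D s p l ρ K z L Λ E) :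
    ∃ C : ℝ≥0∞, C ≠ ⊤ ∧ ∀ v w : Space n → Mat m, (∀ᵐ x ∂(volume.restrict Ω), v x ∈ K) →
      (∀ᵐ x ∂(volume.restrict Ω), w x ∈ K) →
      lpPow p (volume.restrict (Ω \ D)) (Λ ∘ w - Λ ∘ v) ≤ C := by
  refine ⟨ENNReal.ofReal (z + z) ^ p * volume Ω, ENNReal.mul_ne_top
    (ENNReal.rpow_ne_top_of_nonneg S.p_pos.le (by simp)) S.vol_ne_top, fun v w hv hw => ?_⟩
  have hle := Measure.restrict_mono (Set.sdiff_subset : Ω \ D ⊆ Ω) (le_refl volume)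
  refine (lpPow_mono_measure hle _).trans ?_
  rw [lpPow, ← setLIntegral_const]
  refine lintegral_mono_ae ?_
  have hp0 := S.p_pos
  filter_upwards [hv, hw] with x hx1 hx2
  gcongr
  rw [← ofReal_norm]
  exact ENNReal.ofReal_le_ofReal ((norm_sub_le _ _).trans
    (add_le_add (S.chart.norm_le _ hx2) (S.chart.norm_le _ hx1)))

theorem ker_le (S : Setting Ω D s p l ρ K z L Λ E) :
    ∃ C : ℝ≥0∞, C ≠ ⊤ ∧ kerMeas Ω l ρ ≤ C • volSq Ω := by
  obtain ⟨C, hC, h⟩ := S.exists_ker_le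
  refine ⟨C, hC, ?_⟩
  rw [kerMeas, ← withDensity_const]
  exact withDensity_mono (Eventually.of_forall fun q => h _)

theorem ker_ac (_S : Setting Ω D s p l ρ K z L Λ E) : kerMeas Ω l ρ ≪ volSq Ω :=
  withDensity_absolutelyContinuous _ _

theorem phi_lt_top (S : Setting Ω D s p l ρ K z L Λ E) {w : Space n → Mat m}
    (hw : w ∈ WspSet Ω s p K) : Phi Ω s p l ρ w < ⊤ := by
  have hw' := (mem_Wsp_iff S.p_pos).1 hw.1
  rw [S.phi_eq hw'.1 hw.2]
  obtain ⟨C, hC, h⟩ := S.ker_le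
  refine (lpPow_mono_measure h _).trans_lt ?_
  rw [lpPow, lintegral_smul_measure, smul_eq_mul]
  refine ENNReal.mul_lt_top hC.lt_top
    ((diffVec_comp_le S.chart.lip S.p_pos _ w).trans_lt ?_)
  exact ENNReal.mul_lt_top
    (ENNReal.rpow_ne_top_of_nonneg S.p_pos.le ENNReal.coe_ne_top).lt_top hw'.2.2

/-- The regularizer controls the Gagliardo seminorm. -/
theorem coercive (S : Setting Ω D s p l ρ K z L Λ E) :
    ∃ C C' : ℝ≥0∞, C ≠ ⊤ ∧ C' ≠ ⊤ ∧ ∀ w : Space n → Mat m,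
      AEStronglyMeasurable w (volume.restrict Ω) → (∀ᵐ x ∂(volume.restrict Ω), w x ∈ K) →
      lpPow p (volSq Ω) (diffVec s p w) ≤ C * Phi Ω s p l ρ w + C' := by
  have hp0 := S.p_pos
  have hs0 := S.s_pos
  have hfin := S.finite
  obtain ⟨τ, hτ0, hτtop, η, hη, hτ⟩ := S.exists_le_ker
  set c : ℝ≥0∞ := ENNReal.ofReal ((η ^ ((n : ℝ) / p + s))⁻¹ * (z + z)) ^ p with hc
  have hctop : c ≠ ⊤ := ENNReal.rpow_ne_top_of_nonneg hp0.le (by simp)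
  have hLtop : (L : ℝ≥0∞) ^ p ≠ ⊤ := ENNReal.rpow_ne_top_of_nonneg hp0.le ENNReal.coe_ne_top
  refine ⟨(L : ℝ≥0∞) ^ p * τ⁻¹, (L : ℝ≥0∞) ^ p * (c * volSq Ω Set.univ),
    ENNReal.mul_ne_top hLtop (ENNReal.inv_ne_top.2 hτ0),
    ENNReal.mul_ne_top hLtop (ENNReal.mul_ne_top hctop (measure_ne_top _ _)), fun w hw hK => ?_⟩
  have hm := aestronglyMeasurable_diffVec (s := s) (p := p) (S.aesm_comp hw)
  -- Since `E ∘ Λ` is the identity on `K`, the seminorm of `w` is at most that of `Λ ∘ w` up to the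
  -- factor `L ^ p`.
  have h1 : lpPow p (volSq Ω) (diffVec s p w) = lpPow p (volSq Ω) (diffVec s p (E ∘ Λ ∘ w)) := by
    refine lpPow_congr ?_
    filter_upwards [ae_volSq_of_ae hK] with q hq
    simp only [diffVec, Function.comp, S.chart.left_inv _ hq.1, S.chart.left_inv _ hq.2]
  rw [h1, mul_assoc, ← mul_add]
  refine (diffVec_comp_le S.chart.lip' hp0 _ _).trans ?_
  gcongr
  rw [S.phi_eq hw hK, lpPow, lpPow, kerMeas,
    lintegral_withDensity_eq_lintegral_mul₀ S.measurable_ker.aemeasurable (hm.enorm.pow_const p),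
    ← lintegral_const_mul' _ _ (ENNReal.inv_ne_top.2 hτ0), ← lintegral_const,
    ← lintegral_add_right _ measurable_const]
  refine lintegral_mono_ae ?_
  filter_upwards [ae_volSq_of_ae hK] with q hq
  -- Near the diagonal the kernel is at least `τ`. Farther away the denominator exceeds a power of
  -- `η` and the numerator is at most `2 * z`; this accounts for `c`.
  by_cases h : ‖q.1 - q.2‖ ≤ η
  · refine le_add_right ?_
    rw [Pi.mul_apply, ← mul_assoc]
    refine le_mul_of_one_le_left' ?_
    rw [← ENNReal.inv_mul_cancel hτ0 hτtop]
    gcongr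
    exact hτ _ h
  · refine le_add_left ?_
    rw [hc]
    gcongr
    rw [← ofReal_norm]
    refine ENNReal.ofReal_le_ofReal ?_
    rw [diffVec, norm_smul, Real.norm_eq_abs, abs_of_nonneg (by positivity)]
    push Not at h
    have h2 : ‖(Λ ∘ w) q.1 - (Λ ∘ w) q.2‖ ≤ z + z := (norm_sub_le _ _).trans
      (add_le_add (S.chart.norm_le _ hq.1) (S.chart.norm_le _ hq.2))
    gcongr

theorem memLp_of_mem (S : Setting Ω D s p l ρ K z L Λ E) {w : Space n → Mat m}
    (hw : AEStronglyMeasurable w (volume.restrict Ω))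
    (hK : ∀ᵐ x ∂(volume.restrict Ω), w x ∈ K) :
    MemLp w (ENNReal.ofReal p) (volume.restrict Ω) := by
  have hfin := S.finite
  obtain ⟨M, hM⟩ := S.exists_bound
  exact MemLp.of_bound hw M (hK.mono fun x hx => hM _ hx)

theorem mem_WspSet_of (S : Setting Ω D s p l ρ K z L Λ E) {w : Space n → Mat m}
    (hw : AEStronglyMeasurable w (volume.restrict Ω))
    (hK : ∀ᵐ x ∂(volume.restrict Ω), w x ∈ K) (h : lpPow p (volSq Ω) (diffVec s p w) < ⊤) :
    w ∈ WspSet Ω s p K :=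
  ⟨(mem_Wsp_iff S.p_pos).2 ⟨hw, (lpPow_lt_top_iff S.p_pos _).2 (S.memLp_of_mem hw hK).2, h⟩, hK⟩

theorem nonempty_WspSet (S : Setting Ω D s p l ρ K z L Λ E) : ∃ w, w ∈ WspSet Ω s p K := by
  obtain ⟨A, hA⟩ := S.chart.nonempty
  refine ⟨fun _ => A, S.mem_WspSet_of aestronglyMeasurable_const
    (Eventually.of_forall fun _ => hA) ?_⟩
  simp [lpPow, diffVec, S.p_pos]

theorem aesm_of_mem {w : Space n → Mat m} (hw : w ∈ WspSet Ω s p K) :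
    AEStronglyMeasurable w (volume.restrict Ω) := hw.1.1.1

/-- Sequences with bounded regularizer are relatively compact in `L^p`. -/
theorem compact (S : Setting Ω D s p l ρ K z L Λ E) {u : ℕ → Space n → Mat m}
    (hu : ∀ k, u k ∈ WspSet Ω s p K) {B : ℝ≥0∞} (hBtop : B ≠ ⊤)
    (hB : ∀ k, Phi Ω s p l ρ (u k) ≤ B) :
    ∃ φ : ℕ → ℕ, StrictMono φ ∧ ∃ w ∈ WspSet Ω s p K,
      Tendsto (fun k => lpPow p (volume.restrict Ω) (u (φ k) - w)) atTop (𝓝 0) := by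
  have hp0 := S.p_pos
  obtain ⟨C, C', hC, hC', hcoer⟩ := S.coercive
  obtain ⟨M, hM⟩ := S.exists_bound
  have hbd : ∀ k, lpPow p (volSq Ω) (diffVec s p (u k)) ≤ C * B + C' := fun k =>
    (hcoer _ (aesm_of_mem (hu k)) (hu k).2).trans (by gcongr; exact hB k)
  have hbtop : C * B + C' ≠ ⊤ := by finiteness
  obtain ⟨φ, hφ, hcau⟩ := exists_subseq_cauchy S.one_lt_p S.s_pos S.isOpen S.vol_ne_top
    (fun k => aesm_of_mem (hu k)) (fun k => (hu k).2.mono fun x hx => hM _ hx) hbtop hbd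
  obtain ⟨w, hw, hlim⟩ := exists_tendsto_of_lpPow_cauchy S.one_lt_p
    (u := fun k => u (φ k)) (fun k => (hu (φ k)).1.1) hcau
  -- Convergence a.e. keeps the limit in the closed set `K`, and by Fatou its seminorm is finite.
  obtain ⟨ψ, hψ, hae⟩ := exists_subseq_ae_of_tendsto_lpPow hp0
    (fun k => aesm_of_mem (hu (φ k))) hw.1 hlim
  refine ⟨φ, hφ, w, S.mem_WspSet_of hw.1 ?_ ?_, hlim⟩
  · filter_upwards [hae, ae_all_iff.2 fun k => (hu k).2] with x hx hxK
    exact S.chart.isClosed.mem_of_tendsto hx (Eventually.of_forall fun k => hxK _)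
  · refine lt_of_le_of_lt ?_ hbtop.lt_top
    refine (lpPow_le_liminf (fun k => aestronglyMeasurable_diffVec (aesm_of_mem (hu (φ (ψ k)))))
      (tendsto_diffVec hae)).trans ?_
    exact liminf_le_of_frequently_le' (Frequently.of_forall fun k => hbd _)

theorem weakTendsto (S : Setting Ω D s p l ρ K z L Λ E) {u : ℕ → Space n → Mat m}
    (hu : ∀ k, u k ∈ WspSet Ω s p K) {B : ℝ≥0∞} (hBtop : B ≠ ⊤)
    (hB : ∀ k, Phi Ω s p l ρ (u k) ≤ B) {w : Space n → Mat m} (hw : w ∈ WspSet Ω s p K)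
    (hlim : Tendsto (fun k => lpPow p (volume.restrict Ω) (u k - w)) atTop (𝓝 0)) :
    WeakTendsto Ω s p u w := by
  obtain ⟨C, C', hC, hC', hcoer⟩ := S.coercive
  refine weakTendsto_of_tendsto_lpPow S.one_lt_p (fun k => (hu k).1) hw.1 hlim
    (M := C * B + C') (by finiteness) fun k =>
      (hcoer _ (aesm_of_mem (hu k)) (hu k).2).trans (by gcongr; exact hB k)

/-- Lower semicontinuity of the regularizer. -/
theorem phi_lsc (S : Setting Ω D s p l ρ K z L Λ E) {u : ℕ → Space n → Mat m}
    (hu : ∀ k, u k ∈ WspSet Ω s p K) {w : Space n → Mat m} (hw : w ∈ WspSet Ω s p K)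
    (hlim : Tendsto (fun k => lpPow p (volume.restrict Ω) (u k - w)) atTop (𝓝 0)) (c : ℝ≥0∞)
    (hc : ∃ᶠ k in atTop, Phi Ω s p l ρ (u k) ≤ c) : Phi Ω s p l ρ w ≤ c := by
  obtain ⟨φ, hφ, hφc⟩ := extraction_of_frequently_atTop hc
  obtain ⟨ψ, hψ, hae⟩ := exists_subseq_ae_of_tendsto_lpPow S.p_pos
    (fun k => aesm_of_mem (hu (φ k))) (aesm_of_mem hw) (hlim.comp hφ.tendsto_atTop)
  have hae' : ∀ᵐ x ∂(volume.restrict Ω),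
      Tendsto (fun k => (Λ ∘ u (φ (ψ k))) x) atTop (𝓝 ((Λ ∘ w) x)) :=
    hae.mono fun x hx => (S.chart.lip.continuous.tendsto _).comp hx
  rw [S.phi_eq (aesm_of_mem hw) hw.2]
  refine (lpPow_le_liminf (fun k => (aestronglyMeasurable_diffVec (S.aesm_comp
    (aesm_of_mem (hu (φ (ψ k)))))).mono_ac S.ker_ac)
    (S.ker_ac.ae_le (tendsto_diffVec hae'))).trans ?_
  refine liminf_le_of_frequently_le' (Frequently.of_forall fun k => ?_)
  rw [← S.phi_eq (aesm_of_mem (hu _)) (hu _).2]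
  exact hφc _

/-- Continuity of the fidelity term. -/
theorem data_tendsto (S : Setting Ω D s p l ρ K z L Λ E) {u v : ℕ → Space n → Mat m}
    {w v' : Space n → Mat m} (hu : ∀ k, u k ∈ LpSet Ω p K) (hw : w ∈ LpSet Ω p K)
    (hv : ∀ k, v k ∈ LpSet Ω p K) (hv' : v' ∈ LpSet Ω p K)
    (hlim : Tendsto (fun k => lpPow p (volume.restrict Ω) (u k - w)) atTop (𝓝 0))
    (hlim' : Tendsto (fun k => lpPow p (volume.restrict Ω) (v' - v k)) atTop (𝓝 0)) :
    Tendsto (fun k => lpPow p (volume.restrict (Ω \ D)) (Λ ∘ u k - Λ ∘ v k)) atTop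
      (𝓝 (lpPow p (volume.restrict (Ω \ D)) (Λ ∘ w - Λ ∘ v'))) := by
  have hp0 := S.p_pos
  have hle := Measure.restrict_mono (Set.sdiff_subset : Ω \ D ⊆ Ω) (le_refl volume)
  have hm : ∀ {w : Space n → Mat m}, w ∈ LpSet Ω p K →
      AEStronglyMeasurable (Λ ∘ w) (volume.restrict (Ω \ D)) := fun h =>
    S.aesm_comp (h.1.1.mono_measure hle)
  obtain ⟨C, hC, hdata⟩ := S.exists_data_le
  refine tendsto_lpPow_of_tendsto_sub S.one_lt_p.le (fun k => (hm (hu k)).sub (hm (hv k)))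
    ((hm hw).sub (hm hv')) (ne_top_of_le_ne_top hC (hdata _ _ hv'.2 hw.2)) ?_
  have h2top : (2 : ℝ≥0∞) ^ (p - 1) ≠ ⊤ :=
    ENNReal.rpow_ne_top_of_nonneg (by linarith [S.one_lt_p]) (by simp)
  have hLtop : (L : ℝ≥0∞) ^ p ≠ ⊤ := ENNReal.rpow_ne_top_of_nonneg hp0.le ENNReal.coe_ne_top
  have hbound : Tendsto (fun k => (2 : ℝ≥0∞) ^ (p - 1) *
      ((L : ℝ≥0∞) ^ p * lpPow p (volume.restrict Ω) (u k - w) +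
        (L : ℝ≥0∞) ^ p * lpPow p (volume.restrict Ω) (v' - v k))) atTop (𝓝 0) := by
    have h1 := ENNReal.Tendsto.const_mul (a := (L : ℝ≥0∞) ^ p) hlim (Or.inr hLtop)
    have h2 := ENNReal.Tendsto.const_mul (a := (L : ℝ≥0∞) ^ p) hlim' (Or.inr hLtop)
    simpa using ENNReal.Tendsto.const_mul (h1.add h2) (Or.inr h2top)
  refine tendsto_of_tendsto_of_tendsto_of_le_of_le tendsto_const_nhds hbound
    (fun _ => zero_le) fun k => ?_
  have e : (Λ ∘ u k - Λ ∘ v k) - (Λ ∘ w - Λ ∘ v') =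
      (Λ ∘ u k - Λ ∘ w) + (Λ ∘ v' - Λ ∘ v k) := by abel
  simp only
  rw [e]
  refine (lpPow_add_le S.one_lt_p.le ((hm (hu k)).sub (hm hw))).trans ?_
  gcongr
  · exact (lpPow_mono_measure hle _).trans (lpPow_lipschitz_comp_le hp0.le
      (Eventually.of_forall fun x => S.norm_chart_sub_le _ _))
  · exact (lpPow_mono_measure hle _).trans (lpPow_lipschitz_comp_le hp0.le
      (Eventually.of_forall fun x => S.norm_chart_sub_le _ _))

end Setting

/-! ### Minimizers: existence, stability, uniqueness and vanishing noise -/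

namespace Setting

variable {n m : ℕ} {Ω D : Set (Space n)} {s p : ℝ} {l : ℕ} {ρ : Space n → ℝ}
    {K : Set (Mat m)} {z : ℝ} {L : NNReal} {Λ E : Mat m → Mat m}

theorem mem_LpSet {w : Space n → Mat m} (hw : w ∈ WspSet Ω s p K) : w ∈ LpSet Ω p K :=
  ⟨hw.1.1, hw.2⟩

theorem func_lt_top (S : Setting Ω D s p l ρ K z L Λ E) {v w : Space n → Mat m}
    (hv : v ∈ LpSet Ω p K) (hw : w ∈ WspSet Ω s p K) (α : ℝ) : Func Ω D s p l ρ α v w < ⊤ := by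
  obtain ⟨C, hC, hdata⟩ := S.exists_data_le
  rw [S.func_eq hv.2 hw.2]
  exact ENNReal.add_lt_top.2 ⟨(hdata _ _ hv.2 hw.2).trans_lt hC.lt_top,
    ENNReal.mul_lt_top ENNReal.ofReal_lt_top (S.phi_lt_top hw)⟩

/-- Solving for the regularizer turns energy bounds into majorants of the form required by
`le_of_lsc` and `tendsto_of_lsc`; the finite fidelity makes the subtraction legitimate. -/
theorem phi_le_div (S : Setting Ω D s p l ρ K z L Λ E) {v w : Space n → Mat m}
    (hv : v ∈ LpSet Ω p K) (hw : w ∈ WspSet Ω s p K) {α : ℝ} (hα : 0 < α) {c : ℝ≥0∞}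
    (h : Func Ω D s p l ρ α v w ≤ c) :
    Phi Ω s p l ρ w ≤
      (c - lpPow p (volume.restrict (Ω \ D)) (Λ ∘ w - Λ ∘ v)) / ENNReal.ofReal α := by
  obtain ⟨C, hC, hdata⟩ := S.exists_data_le
  rw [S.func_eq hv.2 hw.2] at h
  rw [ENNReal.le_div_iff_mul_le (Or.inl (ENNReal.ofReal_pos.2 hα).ne')
    (Or.inl ENNReal.ofReal_ne_top), mul_comm]
  exact ENNReal.le_sub_of_add_le_left
    (ne_top_of_le_ne_top hC (hdata _ _ hv.2 hw.2)) h

/-- `L^p` limits of almost minimizers for converging data are minimizers, and their regularizer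
values converge. -/
theorem isMinimizer_of_tendsto (S : Setting Ω D s p l ρ K z L Λ E) {α : ℝ} (hα : 0 < α)
    {v : ℕ → Space n → Mat m} {v' : Space n → Mat m} (hv : ∀ k, v k ∈ LpSet Ω p K)
    (hv' : v' ∈ LpSet Ω p K)
    (hvlim : Tendsto (fun k => lpPow p (volume.restrict Ω) (v' - v k)) atTop (𝓝 0))
    {w : ℕ → Space n → Mat m} {w' : Space n → Mat m} (hw : ∀ k, w k ∈ WspSet Ω s p K)
    (hw' : w' ∈ WspSet Ω s p K)
    (hwlim : Tendsto (fun k => lpPow p (volume.restrict Ω) (w k - w')) atTop (𝓝 0))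
    {e : ℕ → ℝ≥0∞} (he : Tendsto e atTop (𝓝 0))
    (hmin : ∀ k, ∀ u ∈ WspSet Ω s p K,
      Func Ω D s p l ρ α (v k) (w k) ≤ Func Ω D s p l ρ α (v k) u + e k) :
    IsMinimizer Ω D s p l ρ K α v' w' ∧
      Tendsto (fun k => Phi Ω s p l ρ (w k)) atTop (𝓝 (Phi Ω s p l ρ w')) := by
  have hp0 := S.p_pos
  have hα0 : ENNReal.ofReal α ≠ 0 := (ENNReal.ofReal_pos.2 hα).ne'
  have hSk := S.data_tendsto (fun k => mem_LpSet (hw k)) (mem_LpSet hw') hv hv' hwlim hvlim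
  obtain ⟨C, hC, hdata⟩ := S.exists_data_le
  have hStop : lpPow p (volume.restrict (Ω \ D)) (Λ ∘ w' - Λ ∘ v') ≠ ⊤ :=
    ne_top_of_le_ne_top hC (hdata _ _ hv'.2 hw'.2)
  have hFu : ∀ u ∈ WspSet Ω s p K,
      Tendsto (fun k => Func Ω D s p l ρ α (v k) u + e k) atTop (𝓝 (Func Ω D s p l ρ α v' u)) := by
    intro u hu
    have h1 := S.data_tendsto (u := fun _ => u) (fun k => mem_LpSet hu) (mem_LpSet hu) hv hv'
      (by simp [lpPow, hp0]) hvlim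
    have h2 := (h1.add_const (ENNReal.ofReal α * Phi Ω s p l ρ u)).add he
    rw [add_zero, ← S.func_eq hv'.2 hu.2] at h2
    exact h2.congr fun k => by rw [S.func_eq (hv k).2 hu.2]
  have hX : ∀ u ∈ WspSet Ω s p K, Tendsto (fun k => (Func Ω D s p l ρ α (v k) u + e k -
      lpPow p (volume.restrict (Ω \ D)) (Λ ∘ w k - Λ ∘ v k)) / ENNReal.ofReal α) atTop
      (𝓝 ((Func Ω D s p l ρ α v' u - lpPow p (volume.restrict (Ω \ D)) (Λ ∘ w' - Λ ∘ v')) /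
        ENNReal.ofReal α)) := fun u hu =>
    ENNReal.Tendsto.div_const (ENNReal.Tendsto.sub (hFu u hu) hSk (Or.inr hStop)) (Or.inr hα0)
  have hlsc := S.phi_lsc hw hw' hwlim
  refine ⟨⟨hw', fun u hu => ?_⟩, ?_⟩
  · have h1 := le_of_lsc hlsc (fun k => S.phi_le_div (hv k) (hw k) hα (hmin k u hu)) (hX u hu)
    rw [ENNReal.le_div_iff_mul_le (Or.inl hα0) (Or.inl ENNReal.ofReal_ne_top), mul_comm] at h1
    -- Subtraction in `ℝ≥0∞` is truncated, so undoing it needs the limiting fidelity to be at most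
    -- the energy of the competitor.
    have h2 : lpPow p (volume.restrict (Ω \ D)) (Λ ∘ w' - Λ ∘ v') ≤ Func Ω D s p l ρ α v' u :=
      le_of_tendsto_of_tendsto' hSk (hFu u hu) fun k => by
        refine le_trans ?_ (hmin k u hu)
        rw [S.func_eq (hv k).2 (hw k).2]
        exact le_self_add
    rw [S.func_eq hv'.2 hw'.2]
    calc _ ≤ _ := add_le_add_right h1 _
      _ = _ := add_tsub_cancel_of_le h2
  -- With the limit `w'` itself as competitor, the majorants converge exactly to its regularizer
  -- value.
  · refine tendsto_of_lsc hlsc (fun k => S.phi_le_div (hv k) (hw k) hα (hmin k w' hw')) ?_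
    convert hX w' hw' using 2
    rw [S.func_eq hv'.2 hw'.2, ENNReal.add_sub_cancel_left hStop, mul_comm,
      ENNReal.mul_div_cancel_right hα0 ENNReal.ofReal_ne_top]

/-- A minimizing sequence consists of almost minimizers for constant data, with errors `1 / (k +
1)`. -/
theorem exists_minimizer (S : Setting Ω D s p l ρ K z L Λ E) {v : Space n → Mat m}
    (hv : v ∈ LpSet Ω p K) {α : ℝ} (hα : 0 < α) : ∃ w, IsMinimizer Ω D s p l ρ K α v w := by
  have hp0 := S.p_pos
  set I : ℝ≥0∞ := ⨅ u ∈ WspSet Ω s p K, Func Ω D s p l ρ α v u with hI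
  obtain ⟨u0, hu0⟩ := S.nonempty_WspSet
  have hItop : I ≠ ⊤ := ne_top_of_le_ne_top (S.func_lt_top hv hu0 α).ne (iInf₂_le u0 hu0)
  have hex : ∀ k : ℕ, ∃ w ∈ WspSet Ω s p K, Func Ω D s p l ρ α v w < I + ((k : ℝ≥0∞) + 1)⁻¹ := by
    intro k
    have h : I < I + ((k : ℝ≥0∞) + 1)⁻¹ :=
      ENNReal.lt_add_right hItop (ENNReal.inv_ne_zero.2 (by finiteness))
    simpa only [hI, iInf_lt_iff, exists_prop] using h
  choose w hw hwI using hex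
  have hα0 : ENNReal.ofReal α ≠ 0 := (ENNReal.ofReal_pos.2 hα).ne'
  have hB : ∀ k, Phi Ω s p l ρ (w k) ≤ (I + 1) / ENNReal.ofReal α := fun k => by
    refine (S.phi_le_div hv (hw k) hα (c := I + 1) ?_).trans ?_
    · refine (hwI k).le.trans ?_
      gcongr
      exact ENNReal.inv_le_one.2 le_add_self
    · gcongr
      exact tsub_le_self
  obtain ⟨φ, hφ, w', hw', hlim⟩ := S.compact hw (ENNReal.div_ne_top (by finiteness) hα0) hB
  have he : Tendsto (fun k : ℕ => ((k : ℝ≥0∞) + 1)⁻¹) atTop (𝓝 0) := by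
    have := (tendsto_add_atTop_iff_nat 1).2 ENNReal.tendsto_inv_nat_nhds_zero
    simpa using this
  refine ⟨w', (S.isMinimizer_of_tendsto hα (v := fun _ => v) (fun _ => hv) hv (by simp [lpPow, hp0])
    (fun k => hw (φ k)) hw' hlim (he.comp hφ.tendsto_atTop) fun k u hu => ?_).1⟩
  refine (hwI (φ k)).le.trans ?_
  simp only [Function.comp]
  gcongr
  exact iInf₂_le u hu

/-- Comparison with one fixed competitor, whose fidelity is bounded uniformly in the data. -/
theorem exists_phi_le (S : Setting Ω D s p l ρ K z L Λ E) {α : ℝ} (hα : 0 < α)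
    {v w : ℕ → Space n → Mat m} (hv : ∀ k, v k ∈ LpSet Ω p K)
    (hw : ∀ k, IsMinimizer Ω D s p l ρ K α (v k) (w k)) :
    ∃ B : ℝ≥0∞, B ≠ ⊤ ∧ ∀ k, Phi Ω s p l ρ (w k) ≤ B := by
  obtain ⟨C, hC, hdata⟩ := S.exists_data_le
  obtain ⟨u0, hu0⟩ := S.nonempty_WspSet
  have hα0 : ENNReal.ofReal α ≠ 0 := (ENNReal.ofReal_pos.2 hα).ne'
  refine ⟨(C + ENNReal.ofReal α * Phi Ω s p l ρ u0) / ENNReal.ofReal α,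
    ENNReal.div_ne_top (ENNReal.add_ne_top.2 ⟨hC, ENNReal.mul_ne_top ENNReal.ofReal_ne_top
      (S.phi_lt_top hu0).ne⟩) hα0, fun k => ?_⟩
  refine (S.phi_le_div (hv k) (hw k).1 hα ((hw k).2 u0 hu0)).trans ?_
  gcongr
  refine tsub_le_self.trans ?_
  rw [S.func_eq (hv k).2 hu0.2]
  gcongr
  exact hdata _ _ (hv k).2 hu0.2

theorem weakTendsto_comp {u : ℕ → Space n → Mat m} {w : Space n → Mat m}
    (h : WeakTendsto Ω s p u w) {ψ : ℕ → ℕ} (hψ : Tendsto ψ atTop atTop) :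
    WeakTendsto Ω s p (fun k => u (ψ k)) w := by
  obtain ⟨hu, hw, hlim⟩ := h
  exact ⟨fun k => hu _, hw, fun f hf => (hlim f hf).comp hψ⟩

theorem lpPow_sub_congr {X V : Type*} [MeasurableSpace X] {μ : Measure X} [NormedAddCommGroup V]
    {w w' : X → V} (h : w =ᵐ[μ] w') (u : X → V) : lpPow p μ (u - w) = lpPow p μ (u - w') :=
  lpPow_congr (EventuallyEq.rfl.sub h)

/-- Weakly converging sequences with bounded regularizer converge in `L^p`. -/
theorem tendsto_of_weakTendsto (S : Setting Ω D s p l ρ K z L Λ E) {u : ℕ → Space n → Mat m}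
    (hu : ∀ k, u k ∈ WspSet Ω s p K) {B : ℝ≥0∞} (hBtop : B ≠ ⊤)
    (hB : ∀ k, Phi Ω s p l ρ (u k) ≤ B) {w : Space n → Mat m} (h : WeakTendsto Ω s p u w) :
    w ∈ WspSet Ω s p K ∧ Tendsto (fun k => lpPow p (volume.restrict Ω) (u k - w)) atTop (𝓝 0) := by
  -- Every subsequence has a further one converging in `L^p`. It also converges weakly to the same
  -- limit, which uniqueness of weak limits identifies with `w`.
  have key : ∀ ns : ℕ → ℕ, Tendsto ns atTop atTop → ∃ ms : ℕ → ℕ, w ∈ WspSet Ω s p K ∧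
      Tendsto (fun k => lpPow p (volume.restrict Ω) (u (ns (ms k)) - w)) atTop (𝓝 0) := by
    intro ns hns
    obtain ⟨ψ, hψ, w', hw', hlim⟩ := S.compact (fun k => hu (ns k)) hBtop fun k => hB (ns k)
    have h1 := S.weakTendsto (fun k => hu (ns (ψ k))) hBtop (fun k => hB _) hw' hlim
    have h2 := weakTendsto_comp h (hns.comp hψ.tendsto_atTop)
    have hae := h1.ae_unique S.one_lt_p S.vol_ne_top h2
    refine ⟨ψ, ⟨h.choose_spec.choose, ?_⟩, ?_⟩
    · filter_upwards [hw'.2, hae] with x hx hx'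
      rwa [← hx']
    · simpa only [lpPow_sub_congr hae] using hlim
  obtain ⟨ms, hms, -⟩ := key id tendsto_id
  exact ⟨hms, tendsto_of_subseq_tendsto fun ns hns => (key ns hns).imp fun ms h => h.2⟩

/-- A true solution is determined by its values where data are available. -/
theorem ae_eq_of_isTrueSolution (S : Setting Ω D s p l ρ K z L Λ E) (hΩc : IsPreconnected Ω)
    (hD0 : volume (Ω \ D) ≠ 0) {w0 w : Space n → Mat m}
    (h0 : IsTrueSolution Ω D s p l ρ K w0) (hw : w ∈ WspSet Ω s p K)
    (hww0 : ∀ᵐ x ∂(volume.restrict (Ω \ D)), w x = w0 x)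
    (hle : Phi Ω s p l ρ w ≤ Phi Ω s p l ρ w0) : w =ᵐ[volume.restrict Ω] w0 := by
  have hp0 := S.p_pos
  have hw0 := h0.1
  have hm0 := aesm_of_mem hw0
  have hm := aesm_of_mem hw
  have hsub := Measure.restrict_mono (Set.sdiff_subset : Ω \ D ⊆ Ω) (le_refl volume)
  have heq : Phi Ω s p l ρ w = Phi Ω s p l ρ w0 := le_antisymm hle (h0.2 w hw hww0)
  -- The competitor is the midpoint taken in the chart, where the regularizer is convex; it keeps
  -- the values of `w0` wherever `w` and `w0` agree.
  let g : Space n → Mat m := (2⁻¹ : ℝ) • (Λ ∘ w0 + Λ ∘ w)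
  let u : Space n → Mat m := E ∘ g
  have hgm : AEStronglyMeasurable g (volume.restrict Ω) :=
    ((S.aesm_comp hm0).add (S.aesm_comp hm)).const_smul _
  have hum : AEStronglyMeasurable u (volume.restrict Ω) :=
    S.chart.lip'.continuous.comp_aestronglyMeasurable hgm
  have huK : ∀ᵐ x ∂(volume.restrict Ω), u x ∈ K := by
    filter_upwards [hw0.2, hw.2] with x hx0 hx
    exact S.chart.mid_mem _ hx0 _ hx
  have hΛu : ∀ᵐ x ∂(volume.restrict Ω), (Λ ∘ u) x = g x := by
    filter_upwards [hw0.2, hw.2] with x hx0 hx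
    exact S.chart.mid_eq _ hx0 _ hx
  have hLtop : (L : ℝ≥0∞) ^ p ≠ ⊤ := ENNReal.rpow_ne_top_of_nonneg hp0.le ENNReal.coe_ne_top
  have hcompfin : ∀ {w : Space n → Mat m}, w ∈ WspSet Ω s p K →
      lpPow p (volSq Ω) (diffVec s p (Λ ∘ w)) < ⊤ := fun {w} hw =>
    (diffVec_comp_le S.chart.lip hp0 _ w).trans_lt
      (ENNReal.mul_lt_top hLtop.lt_top ((mem_Wsp_iff hp0).1 hw.1).2.2)
  have hgfin : lpPow p (volSq Ω) (diffVec s p g) < ⊤ := by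
    have e : diffVec s p g = diffVec s p ((2⁻¹ : ℝ) • (Λ ∘ w0)) +
        diffVec s p ((2⁻¹ : ℝ) • (Λ ∘ w)) := by
      rw [← diffVec_add, ← smul_add]
    have hhalf : ∀ w : Space n → Mat m, lpPow p (volSq Ω) (diffVec s p ((2⁻¹ : ℝ) • (Λ ∘ w))) ≤
        lpPow p (volSq Ω) (diffVec s p (Λ ∘ w)) := by
      intro w
      refine lintegral_mono fun q => ?_
      rw [diffVec_smul, Pi.smul_apply, enorm_smul]
      gcongr
      refine mul_le_of_le_one_left' ?_
      rw [← ofReal_norm]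
      norm_num
    rw [e]
    refine (lpPow_add_le S.one_lt_p.le (aestronglyMeasurable_diffVec
      ((S.aesm_comp hm0).const_smul _))).trans_lt (ENNReal.mul_lt_top
      (ENNReal.rpow_ne_top_of_nonneg (by linarith [S.one_lt_p]) (by simp)).lt_top
      (ENNReal.add_lt_top.2 ⟨(hhalf _).trans_lt (hcompfin hw0), (hhalf _).trans_lt (hcompfin hw)⟩))
  have hu : u ∈ WspSet Ω s p K := S.mem_WspSet_of hum huK
    ((diffVec_comp_le S.chart.lip' hp0 _ g).trans_lt (ENNReal.mul_lt_top hLtop.lt_top hgfin))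
  have huw0 : ∀ᵐ x ∂(volume.restrict (Ω \ D)), u x = w0 x := by
    filter_upwards [hww0, ae_mono hsub hw0.2] with x hx hx0
    have e : g x = Λ (w0 x) := by
      simp only [g, Pi.smul_apply, Pi.add_apply, Function.comp, hx]
      rw [← two_smul ℝ, smul_smul]
      norm_num
    simp only [u, Function.comp, e, S.chart.left_inv _ hx0]
  have hΦu : Phi Ω s p l ρ u = lpPow p (kerMeas Ω l ρ)
      ((2⁻¹ : ℝ) • (diffVec s p (Λ ∘ w0) + diffVec s p (Λ ∘ w))) := by
    rw [S.phi_eq hum huK, ← diffVec_add, ← diffVec_smul]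
    refine lpPow_congr (S.ker_ac.ae_le ?_)
    filter_upwards [ae_volSq_of_ae hΛu] with q hq
    simp only [diffVec, hq.1, hq.2]
    rfl
  have hmD : ∀ {w : Space n → Mat m}, AEStronglyMeasurable w (volume.restrict Ω) →
      AEStronglyMeasurable (diffVec s p (Λ ∘ w)) (kerMeas Ω l ρ) := fun hm =>
    (aestronglyMeasurable_diffVec (S.aesm_comp hm)).mono_ac S.ker_ac
  have hmid := h0.2 u hu huw0
  rw [hΦu] at hmid
  have hfin := S.phi_lt_top hw0
  rw [S.phi_eq hm0 hw0.2] at hmid hfin heq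
  rw [S.phi_eq hm hw.2] at heq
  -- Minimality of `w0` means that the midpoint does not lower the norm, so strict convexity makes
  -- the difference quotients agree a.e. for the kernel measure.
  have hD := ae_eq_of_lpPow_midpoint S.one_lt_p (hmD hm0) (hmD hm) hfin heq hmid
  obtain ⟨τ, hτ0, -, η, hη, hτ⟩ := S.exists_le_ker
  have hloc : ∀ᵐ q ∂(volSq Ω), ‖q.1 - q.2‖ ≤ η →
      (Λ ∘ w0 - Λ ∘ w) q.1 = (Λ ∘ w0 - Λ ∘ w) q.2 := by
    -- At distance at most `η` the density is positive, and off the diagonal the common scalar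
    -- factor cancels.
    have h1 := (ae_withDensity_iff S.measurable_ker).1 hD
    filter_upwards [h1] with q hq hqη
    have h2 := hq (ne_of_gt (lt_of_lt_of_le (pos_iff_ne_zero.2 hτ0) (hτ _ hqη)))
    by_cases hq0 : q.1 = q.2
    · rw [hq0]
    · have h3 : (‖q.1 - q.2‖ ^ ((n : ℝ) / p + s))⁻¹ ≠ 0 :=
        inv_ne_zero (Real.rpow_pos_of_pos (norm_pos_iff.2 (sub_ne_zero.2 hq0)) _).ne'
      have h4 := smul_right_injective (Mat m) h3 h2
      simp only [Pi.sub_apply]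
      rw [sub_eq_sub_iff_sub_eq_sub]
      exact h4
  have hΩD : NullMeasurableSet (Ω \ D) volume :=
    S.isOpen.measurableSet.nullMeasurableSet.diff S.nullMeas
  have hzero := ae_eq_zero_of_locally_const hη S.isOpen hΩc hloc Set.sdiff_subset hΩD hD0
    (hww0.mono fun x hx => by simp [hx])
  filter_upwards [hzero, hw0.2, hw.2] with x hx hx0 hx1
  rw [← S.chart.left_inv _ hx0, ← S.chart.left_inv _ hx1]
  congr 1
  exact (sub_eq_zero.1 hx).symm

/-- Convergence of the regularized solutions to the true solution as the noise vanishes. -/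
theorem convergence (S : Setting Ω D s p l ρ K z L Λ E) (hΩc : IsPreconnected Ω)
    (hD0 : volume (Ω \ D) ≠ 0) {w0 : Space n → Mat m} (h0 : IsTrueSolution Ω D s p l ρ K w0)
    {a δ : ℕ → ℝ} (ha : ∀ k, 0 < a k) (halim : Tendsto a atTop (𝓝 0)) (hδ : ∀ k, 0 < δ k)
    (hδlim : Tendsto δ atTop (𝓝 0)) (hδa : Tendsto (fun k => δ k ^ p / a k) atTop (𝓝 0))
    {v w : ℕ → Space n → Mat m} (hv : ∀ k, v k ∈ LpSet Ω p K)
    (hvδ : ∀ k, eLpNorm (w0 - v k) (ENNReal.ofReal p) (volume.restrict Ω) ≤ ENNReal.ofReal (δ k))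
    (hw : ∀ k, IsMinimizer Ω D s p l ρ K (a k) (v k) (w k)) :
    WeakTendsto Ω s p w w0 ∧
      Tendsto (fun k => Phi Ω s p l ρ (w k)) atTop (𝓝 (Phi Ω s p l ρ w0)) := by
  have hp0 := S.p_pos
  have hw0 := h0.1
  have hsub := Measure.restrict_mono (Set.sdiff_subset : Ω \ D ⊆ Ω) (le_refl volume)
  have hLtop : (L : ℝ≥0∞) ^ p ≠ ⊤ := ENNReal.rpow_ne_top_of_nonneg hp0.le ENNReal.coe_ne_top
  have hΦtop := (S.phi_lt_top hw0).ne
  have hvp : ∀ k, lpPow p (volume.restrict Ω) (w0 - v k) ≤ ENNReal.ofReal (δ k ^ p) := fun k => by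
    rw [← eLpNorm_rpow_eq_lpPow hp0, ← ENNReal.ofReal_rpow_of_pos (hδ k)]
    gcongr
    exact hvδ k
  have hδp : Tendsto (fun k => ENNReal.ofReal (δ k ^ p)) atTop (𝓝 0) := by
    have := ENNReal.tendsto_ofReal (((Real.continuous_rpow_const hp0.le).tendsto 0).comp hδlim)
    simpa [Real.zero_rpow hp0.ne', Function.comp_def] using this
  have hvlim : Tendsto (fun k => lpPow p (volume.restrict Ω) (w0 - v k)) atTop (𝓝 0) :=
    tendsto_of_tendsto_of_tendsto_of_le_of_le tendsto_const_nhds hδp (fun _ => zero_le) hvp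
  -- Minimality is tested with `w0`, whose fidelity is at most `L ^ p * δ ^ p` by the Lipschitz
  -- bound for the chart.
  have hF : ∀ k, Func Ω D s p l ρ (a k) (v k) (w k) ≤
      (L : ℝ≥0∞) ^ p * ENNReal.ofReal (δ k ^ p) + ENNReal.ofReal (a k) * Phi Ω s p l ρ w0 := by
    intro k
    refine ((hw k).2 w0 hw0).trans ?_
    rw [S.func_eq (hv k).2 hw0.2]
    gcongr
    refine (lpPow_mono_measure hsub _).trans ((lpPow_lipschitz_comp_le hp0.le
      (Eventually.of_forall fun x => S.norm_chart_sub_le _ _)).trans ?_)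
    gcongr
    exact hvp k
  have ha0 : ∀ k, ENNReal.ofReal (a k) ≠ 0 := fun k => (ENNReal.ofReal_pos.2 (ha k)).ne'
  -- Dividing by the parameter leaves `δ ^ p / a`, which vanishes in the limit, plus the regularizer
  -- of `w0`.
  let X : ℕ → ℝ≥0∞ := fun k =>
    (L : ℝ≥0∞) ^ p * ENNReal.ofReal (δ k ^ p / a k) + Phi Ω s p l ρ w0
  have hΦX : ∀ k, Phi Ω s p l ρ (w k) ≤ X k := by
    intro k
    refine (S.phi_le_div (hv k) (hw k).1 (ha k) (hF k)).trans ?_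
    calc _ ≤ ((L : ℝ≥0∞) ^ p * ENNReal.ofReal (δ k ^ p) +
          ENNReal.ofReal (a k) * Phi Ω s p l ρ w0) / ENNReal.ofReal (a k) := by
          gcongr
          exact tsub_le_self
      _ = X k := by
          rw [ENNReal.add_div, mul_div_assoc, ← ENNReal.ofReal_div_of_pos (ha k), mul_comm
            (ENNReal.ofReal (a k)), ENNReal.mul_div_cancel_right (ha0 k) ENNReal.ofReal_ne_top]
  have hX : Tendsto X atTop (𝓝 (Phi Ω s p l ρ w0)) := by
    have h1 := (ENNReal.Tendsto.const_mul (a := (L : ℝ≥0∞) ^ p) (ENNReal.tendsto_ofReal hδa)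
      (Or.inr hLtop)).add_const (Phi Ω s p l ρ w0)
    simpa using h1
  have hdata : Tendsto (fun k => lpPow p (volume.restrict (Ω \ D)) (Λ ∘ w k - Λ ∘ v k)) atTop
      (𝓝 0) := by
    have h1 := (ENNReal.Tendsto.const_mul (a := (L : ℝ≥0∞) ^ p) hδp (Or.inr hLtop)).add
      (ENNReal.Tendsto.mul_const (ENNReal.tendsto_ofReal halim) (Or.inr hΦtop))
    refine tendsto_of_tendsto_of_tendsto_of_le_of_le tendsto_const_nhds (by simpa using h1)
      (fun _ => zero_le) fun k => le_trans ?_ (hF k)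
    rw [S.func_eq (hv k).2 (hw k).1.2]
    exact le_self_add
  obtain ⟨B, hBtop, hB⟩ : ∃ B : ℝ≥0∞, B ≠ ⊤ ∧ ∀ k, Phi Ω s p l ρ (w k) ≤ B := by
    obtain ⟨b, hb⟩ := hδa.bddAbove_range
    refine ⟨(L : ℝ≥0∞) ^ p * ENNReal.ofReal b + Phi Ω s p l ρ w0, by finiteness, fun k =>
      (hΦX k).trans ?_⟩
    simp only [X]
    gcongr
    exact hb ⟨k, rfl⟩
  -- Since the limit of any convergent further subsequence must be `w0`, the whole sequence
  -- converges in `L^p`.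
  have hwlim : Tendsto (fun k => lpPow p (volume.restrict Ω) (w k - w0)) atTop (𝓝 0) := by
    refine tendsto_of_subseq_tendsto fun ns hns => ?_
    obtain ⟨ψ, hψ, w', hw', hlim⟩ := S.compact (fun k => (hw (ns k)).1) hBtop fun k => hB (ns k)
    have hnsψ := hns.comp hψ.tendsto_atTop
    have hΦ : Phi Ω s p l ρ w' ≤ Phi Ω s p l ρ w0 :=
      le_of_lsc (S.phi_lsc (fun k => (hw (ns (ψ k))).1) hw' hlim) (fun k => hΦX _) (hX.comp hnsψ)
    have h1 := S.data_tendsto (fun k => mem_LpSet (hw (ns (ψ k))).1) (mem_LpSet hw')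
      (fun k => hv (ns (ψ k))) (mem_LpSet hw0) hlim (hvlim.comp hnsψ)
    have h2 := tendsto_nhds_unique h1 (hdata.comp hnsψ)
    have hmD : ∀ {w : Space n → Mat m}, w ∈ WspSet Ω s p K →
        AEStronglyMeasurable (Λ ∘ w) (volume.restrict (Ω \ D)) := fun h =>
      S.aesm_comp ((aesm_of_mem h).mono_measure hsub)
    have h3 := (lpPow_eq_zero_iff hp0 ((hmD hw').sub (hmD hw0))).1 h2
    have h4 : ∀ᵐ x ∂(volume.restrict (Ω \ D)), w' x = w0 x := by
      filter_upwards [h3, ae_mono hsub hw'.2, ae_mono hsub hw0.2] with x hx hx1 hx2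
      rw [← S.chart.left_inv _ hx1, ← S.chart.left_inv _ hx2]
      congr 1
      exact sub_eq_zero.1 hx
    have hae := S.ae_eq_of_isTrueSolution hΩc hD0 h0 hw' h4 hΦ
    exact ⟨ψ, by simpa only [lpPow_sub_congr hae] using hlim⟩
  exact ⟨S.weakTendsto (fun k => (hw k).1) hBtop hB hw0 hwlim,
    tendsto_of_lsc (S.phi_lsc (fun k => (hw k).1) hw0 hwlim) hΦX hX⟩

end Setting

end TensorReg

/-! ### The main theorem -/

theorem mainTheorem2 (n m : ℕ) (Ω D : Set (Space n))
    (hΩne : Ω.Nonempty) (hΩb : Bornology.IsBounded Ω) (hΩc : IsConnected Ω) (hΩo : IsOpen Ω)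
    (hΩL : HasLipschitzBoundary Ω) (hDΩ : D ⊆ Ω) (hD : NullMeasurableSet D volume)
    (s p : ℝ) (hs0 : 0 < s) (hs1 : s < 1) (hp : 1 < p) (l : ℕ) (hl : l = 0 ∨ l = 1)
    (ρ : Space n → ℝ) (hρ : IsMollifier ρ) (z : ℝ) (hz : 0 ≤ z) :
    -- the functional is finite on `W^{s,p}(Ω; K)`
    (∀ v ∈ LpSet Ω p (SPDLog m z), ∀ α : ℝ, 0 < α → ∀ w ∈ WspSet Ω s p (SPDLog m z),
      Func Ω D s p l ρ α v w < ⊤) ∧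
    -- existence
    (∀ v ∈ LpSet Ω p (SPDLog m z), ∀ α : ℝ, 0 < α →
      ∃ w, IsMinimizer Ω D s p l ρ (SPDLog m z) α v w) ∧
    -- stability
    (∀ α : ℝ, 0 < α → ∀ wδ ∈ LpSet Ω p (SPDLog m z), ∀ v : ℕ → Space n → Mat m,
      (∀ k, v k ∈ LpSet Ω p (SPDLog m z)) →
      Tendsto (fun k => eLpNorm (wδ - v k) (ENNReal.ofReal p) (volume.restrict Ω)) atTop (𝓝 0) →
      ∀ w : ℕ → Space n → Mat m,
      (∀ k, IsMinimizer Ω D s p l ρ (SPDLog m z) α (v k) (w k)) →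
      (∃ φ : ℕ → ℕ, StrictMono φ ∧ ∃ w' : Space n → Mat m,
        WeakTendsto Ω s p (fun j => w (φ j)) w') ∧
      (∀ φ : ℕ → ℕ, StrictMono φ → ∀ w' : Space n → Mat m,
        WeakTendsto Ω s p (fun j => w (φ j)) w' →
        IsMinimizer Ω D s p l ρ (SPDLog m z) α wδ w' ∧
        Tendsto (fun j => Phi Ω s p l ρ (w (φ j))) atTop (𝓝 (Phi Ω s p l ρ w')))) ∧
    -- convergence
    (volume (Ω \ D) ≠ 0 →
      ∀ w0 : Space n → Mat m, IsTrueSolution Ω D s p l ρ (SPDLog m z) w0 →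
      ∀ α : ℝ → ℝ, (∀ δ, 0 < δ → 0 < α δ) →
      Tendsto α (𝓝[>] 0) (𝓝 0) → Tendsto (fun δ => δ ^ p / α δ) (𝓝[>] 0) (𝓝 0) →
      ∀ δ : ℕ → ℝ, (∀ k, 0 < δ k) → Tendsto δ atTop (𝓝 0) →
      ∀ v : ℕ → Space n → Mat m, (∀ k, v k ∈ LpSet Ω p (SPDLog m z)) →
      (∀ k, eLpNorm (w0 - v k) (ENNReal.ofReal p) (volume.restrict Ω) ≤ ENNReal.ofReal (δ k)) →
      ∀ w : ℕ → Space n → Mat m,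
      (∀ k, IsMinimizer Ω D s p l ρ (SPDLog m z) (α (δ k)) (v k) (w k)) →
      (∃ φ : ℕ → ℕ, StrictMono φ ∧ WeakTendsto Ω s p (fun j => w (φ j)) w0 ∧
        Tendsto (fun j => Phi Ω s p l ρ (w (φ j))) atTop (𝓝 (Phi Ω s p l ρ w0))) ∧
      WeakTendsto Ω s p w w0 ∧
      Tendsto (fun k => Phi Ω s p l ρ (w k)) atTop (𝓝 (Phi Ω s p l ρ w0))) := by
  obtain ⟨L, Λ, E, hchart, hlog⟩ := exists_isChart_SPDLog m hz
  have S : Setting Ω D s p l ρ (SPDLog m z) z L Λ E :=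
    ⟨hchart, hlog, hp, hs0, hΩo, hΩb.measure_lt_top.ne, hD, hρ, hl⟩
  refine ⟨fun v hv α _ w hw => S.func_lt_top hv hw α, fun v hv α hα => S.exists_minimizer hv hα,
    fun α hα wδ hwδ v hv hvlim w hw => ?_, fun hD0 w0 h0 α hα hα0 hδα δ hδ hδ0 v hv hvδ w hw => ?_⟩
  · obtain ⟨B, hBtop, hB⟩ := S.exists_phi_le hα hv hw
    refine ⟨?_, fun φ hφ w' hweak => ?_⟩
    · obtain ⟨φ, hφ, w', hw', hlim⟩ := S.compact (fun k => (hw k).1) hBtop hB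
      exact ⟨φ, hφ, w', S.weakTendsto (fun k => (hw (φ k)).1) hBtop (fun k => hB _) hw' hlim⟩
    · obtain ⟨hw', hlim⟩ := S.tendsto_of_weakTendsto (fun k => (hw (φ k)).1) hBtop
        (fun k => hB _) hweak
      -- Exact minimizers are almost minimizers with error zero.
      exact S.isMinimizer_of_tendsto hα (fun k => hv (φ k)) hwδ
        (((tendsto_lpPow_zero_iff S.p_pos _).2 hvlim).comp hφ.tendsto_atTop)
        (fun k => (hw (φ k)).1) hw' hlim (tendsto_const_nhds (x := (0 : ℝ≥0∞)))
        fun k u hu => by simpa using (hw (φ k)).2 u hu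
  · have hδ0' : Tendsto δ atTop (𝓝[>] 0) :=
      tendsto_nhdsWithin_iff.2 ⟨hδ0, Eventually.of_forall hδ⟩
    have h := S.convergence hΩc.isPreconnected hD0 h0 (fun k => hα _ (hδ k)) (hα0.comp hδ0') hδ hδ0
      (hδα.comp hδ0') hv hvδ hw
    exact ⟨⟨id, strictMono_id, h⟩, h⟩
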